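/- Setting. Let $\mathcal X\subset\mathbb R^p$, and for $\mathbf x\in\mathcal X$ let $Y(\mathbf x)\ge 0$ have distribution function $F_Y(\cdot|\mathbf x)$, density $f_Y(\cdot|\mathbf x)$ and quantile function $F_Y^{-1}(\cdot|\mathbf x)$. Let $\mathbf x_1,\mathbf x_2,\dots\in\mathcal X$ be fixed design points and $y_1,y_2,\dots$ independent random variables, $y_i$ distributed as $Y(\mathbf x_i)$. QRGMM. For $\tau\in(0,1)$ let $\rho_\tau(u)=[\tau-1\{u\le 0\}]u$. Given $n$ and $m$, put $\tau_j=j/m$ and let $\hat\beta(\tau_j)$, $1\le j\le m-1$, be any (measurable) minimizer of $\beta\mapsto\sum_{i=1}^n\rho_{\tau_j}(y_i-\beta^\top\mathbf x_i)$ over $\mathbb R^p$; put $\hat Q_{\tau_j}(\mathbf x)=\hat\beta(\tau_j)^\top\mathbf x$. Let $U$ be uniform on $(0,1)$, independent of the data. Then $\hat Y(\mathbf x)=\hat Q_{\tau_1}(\mathbf x)$ if $U<\tau_1$, $\hat Y(\mathbf x)=\hat Q_{\tau_{m-1}}(\mathbf x)$ if $U\ge\tau_{m-1}$, and $\hat Y(\mathbf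 x)=\hat Q_{\tau_j}(\mathbf x)+m(U-\tau_j)[\hat Q_{\tau_{j+1}}(\mathbf x)-\hat Q_{\tau_j}(\mathbf x)]$ if $\tau_j\le U<\tau_{j+1}$, $1\le j\le m-2$. Assumptions. (1) $F_Y^{-1}(\tau|\mathbf x)=\beta(\tau)^\top\mathbf x$ for all $\tau\in(0,1)$, $\mathbf x\in\mathcal X$, with $\beta$ continuous on $(0,1)$. (2) The laws of $Y(\mathbf x)$, $\mathbf x\in\mathcal X$, are absolutely continuous with a common support, and for all $0<\tau_\ell<\tau_u<1$ the values $f_Y(F_Y^{-1}(\tau|\mathbf x)|\mathbf x)$, $\tau\in[\tau_\ell,\tau_u]$, $\mathbf x\in\mathcal X$, are bounded away from $0$ and $\infty$. (3) For all $0<\tau_\ell<\tau_u<1$ there are positive definite matrices $D_0$ and $D_1(\tau)$ with $\frac1n\sum_{i=1}^n\mathbf x_i\mathbf x_i^\top\to D_0$ and $\frac1n\sum_{i=1}^n f_Y(F_Y^{-1}(\tau|\mathbf x_i)|\mathbf x_i)\,\mathbf x_i\mathbf x_i^\top\to D_1(\tau)$ uniformly for $\tau\in[\tau_\ell,\tau_u]$;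 and $\max_{i\le n}\|\mathbf x_i\|=o(\sqrt n)$. (4) $\bar l>0$; $a$ is monotone on $[0,\bar l]$ with $0\le a(l)\le a(\bar l)<\infty$ there and $a(l)\to0$ as $l\downarrow0$; for every $l\in[0,\bar l]$ the function $g_l$ is differentiable on $[0,a(\bar l)]$, Lipschitz there with a constant $K$ not depending on $l$, and $|g_l(y)|\le g_{\bar l}(0)$ for $y\in[0,a(\bar l)]$. Theorem. Let $m=m(n)$ satisfy $m\to\infty$ and $n/m\to\infty$ as $n\to\infty$, and fix $\mathbf x\in\mathcal X$. Put $$r_3(l)=\mathbb E\big[g_l(Y(\mathbf x))\,1\{Y(\mathbf x)<a(l)\}\big],\qquad \hat r_3(l)=\mathbb E\big[g_l(\hat Y(\mathbf x))\,1\{\hat Y(\mathbf x)<a(l)\}\big],$$ where $g_l(y)$ is read as $0$ for $y<0$. Then $$\sup_{l\in[0,\bar l]}|\hat r_3(l)-r_3(l)|\longrightarrow 0\qquad(n\to\infty),$$ both when the expectation in $\hat r_3$ is over $U$ given the data, with convergence in probability, and when it is over $U$ and the data, with convergence of real numbers. If every $g_l$, $l\in[0,\bar l]$, is a measurable function on $\mathbb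 R$ with $|g_l(y)|\le g_{\bar l}(0)$ also for $y<0$, then the same holds with the values $g_l(y)$, $y<0$, kept. -/

import Mathlib

open MeasureTheory ProbabilityTheory Filter Topology Set

open scoped ENNReal NNReal

noncomputable section

/-- The quantile function `F⁻¹(τ) = inf {y | τ ≤ F(y)}` of a law `ν` on the line, for `0 < τ < 1`. -/
def quantile (ν : Measure ℝ) (τ : ℝ) : ℝ :=
  sInf {y : ℝ | τ ≤ cdf ν y}

/-- The pinball loss `ρ_τ(u) = (τ - 1{u ≤ 0}) u`. -/
def pinball (τ u : ℝ) : ℝ :=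
  (τ - (if u ≤ 0 then 1 else 0)) * u

/-- `b` minimizes the empirical pinball loss `∑ ρ_τ(y_i - bᵀ x_i)` over the first `n` data points:
`b` is a linear quantile regression estimate at level `τ`. -/
def IsQuantileRegression {p : ℕ} (n : ℕ) (xs : ℕ → EuclideanSpace ℝ (Fin p)) (ys : ℕ → ℝ) (τ : ℝ)
    (b : EuclideanSpace ℝ (Fin p)) : Prop :=
  ∀ b' : EuclideanSpace ℝ (Fin p),
    ∑ i ∈ Finset.range n, pinball τ (ys i - inner ℝ b (xs i)) ≤
      ∑ i ∈ Finset.range n, pinball τ (ys i - inner ℝ b' (xs i))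

/-- The generator of QRGMM with the grid `j / m`, `1 ≤ j ≤ m - 1`, and with the fitted quantiles
`q j` at the grid points: the input `u ∈ (0,1)` is mapped to the piecewise linear interpolation of
the fitted quantiles, which is constant below the first and above the last grid point. -/
def qrgmm (m : ℕ) (q : ℕ → ℝ) (u : ℝ) : ℝ :=
  if u < 1 / (m : ℝ) then q 1
  else if ((m : ℝ) - 1) / m ≤ u then q (m - 1)
  else q ⌊(m : ℝ) * u⌋₊ +
    m * (u - (⌊(m : ℝ) * u⌋₊ : ℝ) / m) * (q (⌊(m : ℝ) * u⌋₊ + 1) - q ⌊(m : ℝ) * u⌋₊)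

/-- The uniform distribution on `(0,1)`. -/
def unifLaw : Measure ℝ := volume.restrict (Ioo 0 1)

/-- The law of the generated `Ŷ(x)` when the coefficients `b j`, fitted at the levels `j / m`, are
held fixed (the law given the data). -/
def genLaw {p : ℕ} (m : ℕ) (b : ℕ → EuclideanSpace ℝ (Fin p)) (x : EuclideanSpace ℝ (Fin p)) :
    Measure ℝ :=
  unifLaw.map (qrgmm m fun j => inner ℝ (b j) x)

/-- The law of the generated `Ŷ(x)` when both the data, on which the coefficients depend, and the
uniform input, which is independent of the data, are random. -/
def genLawJoint {p : ℕ} {Ω : Type*} [MeasurableSpace Ω] (P : Measure Ω) (m : ℕ)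
    (b : ℕ → Ω → EuclideanSpace ℝ (Fin p)) (x : EuclideanSpace ℝ (Fin p)) : Measure ℝ :=
  (P.prod unifLaw).map fun z => qrgmm m (fun j => inner ℝ (b j z.1) x) z.2

/-- The risk measure `r₃(l) = E[g_l(Y) 1{Y < a(l)}]` of a variable `Y` with law `ν`. -/
def riskThree (g : ℝ → ℝ → ℝ) (a : ℝ → ℝ) (ν : Measure ℝ) (l : ℝ) : ℝ :=
  ∫ y, (Iio (a l)).indicator (g l) y ∂ν

/-- `sup_{l ∈ [0, lbar]} |r l - s l|`, as an extended nonnegative real. -/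
def supDist (lbar : ℝ) (r s : ℝ → ℝ) : ℝ≥0∞ :=
  ⨆ l ∈ Icc 0 lbar, ENNReal.ofReal |r l - s l|

/-- The conditional laws `μ x` of the nonnegative variable `Y(x)`, `x ∈ X`, follow the linear
quantile model `F⁻¹(τ | x) = β(τ)ᵀ x` for all `τ ∈ (0,1)`, with `β` continuous. -/
structure LinearQuantileModel {p : ℕ} (X : Set (EuclideanSpace ℝ (Fin p)))
    (μ : EuclideanSpace ℝ (Fin p) → Measure ℝ) (β : ℝ → EuclideanSpace ℝ (Fin p)) : Prop where
  prob : ∀ x ∈ X, IsProbabilityMeasure (μ x)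
  nonneg : ∀ x ∈ X, μ x (Iio 0) = 0
  linear : ∀ x ∈ X, ∀ τ ∈ Ioo (0 : ℝ) 1, quantile (μ x) τ = inner ℝ (β τ) x
  cont : ContinuousOn β (Ioo 0 1)

/-- The laws `μ x`, `x ∈ X`, have a common support and densities `f x`, and on every compact
interval of levels the densities at the quantiles are bounded away from `0` and `∞`. -/
structure RegularDensities {p : ℕ} (X : Set (EuclideanSpace ℝ (Fin p)))
    (μ : EuclideanSpace ℝ (Fin p) → Measure ℝ) (f : EuclideanSpace ℝ (Fin p) → ℝ → ℝ) : Prop where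
  meas : ∀ x ∈ X, Measurable (f x)
  nonneg : ∀ x ∈ X, ∀ y, 0 ≤ f x y
  density : ∀ x ∈ X, μ x = volume.withDensity fun y => ENNReal.ofReal (f x y)
  support : ∃ S : Set ℝ, ∀ x ∈ X, (μ x).support = S
  bounds : ∀ τl τu : ℝ, 0 < τl → τl < τu → τu < 1 → ∃ c C : ℝ, 0 < c ∧
    ∀ τ ∈ Icc τl τu, ∀ x ∈ X, c ≤ f x (quantile (μ x) τ) ∧ f x (quantile (μ x) τ) ≤ C

/-- The conditions on the design points `xs 0, xs 1, …`: convergence of the (weighted) second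
moment matrices to positive definite limits, and `max_{i < n} ‖xs i‖ = o(√n)`. -/
structure RegularDesign {p : ℕ} (xs : ℕ → EuclideanSpace ℝ (Fin p))
    (μ : EuclideanSpace ℝ (Fin p) → Measure ℝ) (f : EuclideanSpace ℝ (Fin p) → ℝ → ℝ) : Prop where
  moments : ∀ τl τu : ℝ, 0 < τl → τl < τu → τu < 1 →
    ∃ (D₀ : Matrix (Fin p) (Fin p) ℝ) (D₁ : ℝ → Matrix (Fin p) (Fin p) ℝ),
      D₀.PosDef ∧ (∀ τ ∈ Icc τl τu, (D₁ τ).PosDef) ∧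
      Tendsto (fun n : ℕ => (1 / (n : ℝ)) •
        ∑ i ∈ Finset.range n, Matrix.vecMulVec (xs i).ofLp (xs i).ofLp) atTop (𝓝 D₀) ∧
      TendstoUniformlyOn (fun (n : ℕ) (τ : ℝ) => (1 / (n : ℝ)) •
        ∑ i ∈ Finset.range n,
          f (xs i) (quantile (μ (xs i)) τ) • Matrix.vecMulVec (xs i).ofLp (xs i).ofLp)
        D₁ atTop (Icc τl τu)
  maxNorm : (fun n : ℕ => ⨆ i : Fin n, ‖xs i‖) =o[atTop] fun n : ℕ => Real.sqrt n

/-- The conditions on the threshold `a` and on the family `g_l`, with Lipschitz constant `K`. -/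
structure RegularRisk (lbar : ℝ) (a : ℝ → ℝ) (g : ℝ → ℝ → ℝ) (K : ℝ≥0) : Prop where
  mono : MonotoneOn a (Icc 0 lbar)
  range : ∀ l ∈ Icc 0 lbar, 0 ≤ a l ∧ a l ≤ a lbar
  vanish : Tendsto a (𝓝[>] 0) (𝓝 0)
  diff : ∀ l ∈ Icc 0 lbar, DifferentiableOn ℝ (g l) (Icc 0 (a lbar))
  lip : ∀ l ∈ Icc 0 lbar, LipschitzOnWith K (g l) (Icc 0 (a lbar))
  bound : ∀ l ∈ Icc 0 lbar, ∀ y ∈ Icc 0 (a lbar), |g l y| ≤ g lbar 0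

/-- Uniform convergence of the QRGMM estimate of the risk measure given by `g` and `a` to the one
of the law `ν`: for the estimate computed from the law given the data, in probability; and for the
estimate computed from the joint law of data and uniform input, as a sequence of functions. -/
def RiskConverges {p : ℕ} {Ω : Type*} [MeasurableSpace Ω] (P : Measure Ω) (m : ℕ → ℕ)
    (b : ℕ → ℕ → Ω → EuclideanSpace ℝ (Fin p)) (x : EuclideanSpace ℝ (Fin p)) (ν : Measure ℝ)
    (lbar : ℝ) (g : ℝ → ℝ → ℝ) (a : ℝ → ℝ) : Prop :=
  (∀ ε : ℝ≥0∞, 0 < ε →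
    Tendsto (fun n => P {ω | ε ≤ supDist lbar
      (riskThree g a (genLaw (m n) (fun j => b n j ω) x)) (riskThree g a ν)}) atTop (𝓝 0)) ∧
  Tendsto (fun n => supDist lbar
    (riskThree g a (genLawJoint P (m n) (b n) x)) (riskThree g a ν)) atTop (𝓝 0)

end

/-! Both variables are coupled through the same uniform input: `Y(x)` has the law of `β(U)ᵀx`, so
the generated value only has to be close to `β(U)ᵀx` in probability. For a fixed input `u` just the
two grid levels next to `u` matter, and both tend to `u`. Consistency of quantile regression along a
convergent sequence of levels (`tendsto_measure_quantileRegression`) therefore suffices, with no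
uniformity over the grid; dominated convergence in `u` gives convergence on the product space
(`tendsto_measure_qrgmm`, then `theorem3`).

Consistency rests on convexity: an estimate at distance at least `r` from the truth forces the
objective, somewhere on the sphere of radius `r`, to be no larger than at the truth.
`pinball_increment_ge` bounds increments from below through a window around the true quantile, whose
ends are the quantiles at levels `τ ± κ r ‖x_i‖`. With these levels the expectations are exact: the
score is centred and the normalised window indicators average to the Gram matrix, so the density
needs no expansion; its lower bound only controls the width of the window. Chebyshev's inequality
handles the fluctuations, and positive definiteness of the limiting Gram matrix makes the increment
positive on the sphere.

For the risk, `g_l` is Lipschitz between `0` and `a(l)`, and a jump matters only if `Y` lies near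
`0` or `a(l)`. By absolute continuity this has small probability uniformly in the location, hence in
`l`. Markov's inequality passes from the joint law to the law given the data. -/

/-! ### Quantile functions and short intervals. -/

/-- Right continuity of the cdf makes the infimum attained. The bounds on `τ` make the set nonempty
and bounded below, so that `sInf` is a true infimum. -/
theorem quantile_le_iff (ν : Measure ℝ) {τ : ℝ} (h0 : 0 < τ) (h1 : τ < 1) (y : ℝ) :
    quantile ν τ ≤ y ↔ τ ≤ cdf ν y := by
  have hbdd : BddBelow {y : ℝ | τ ≤ cdf ν y} := by
    obtain ⟨z, hz⟩ := ((tendsto_cdf_atBot ν).eventually (gt_mem_nhds h0)).exists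
    refine ⟨z, fun w hw => ?_⟩
    by_contra! hlt
    exact absurd (hw.trans (monotone_cdf ν hlt.le)) (not_le.2 hz)
  have hne : {y : ℝ | τ ≤ cdf ν y}.Nonempty := by
    obtain ⟨z, hz⟩ := ((tendsto_cdf_atTop ν).eventually (lt_mem_nhds h1)).exists
    exact ⟨z, hz.le⟩
  refine ⟨fun h => ?_, fun h => csInf_le hbdd h⟩
  have hr : Tendsto (cdf ν) (𝓝[>] y) (𝓝 (cdf ν y)) :=
    ((cdf ν).right_continuous y).mono_left (nhdsWithin_mono _ Ioi_subset_Ici_self)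
  refine ge_of_tendsto hr (eventually_nhdsWithin_of_forall fun z hz => ?_)
  obtain ⟨s, hs, hsz⟩ := exists_lt_of_csInf_lt hne (h.trans_lt hz)
  exact le_trans hs (monotone_cdf ν hsz.le)

/-- Without atoms the cdf is also left continuous, and to the left of the quantile it stays below
`τ`. -/
theorem cdf_quantile (ν : Measure ℝ) [IsProbabilityMeasure ν] [NullSingletonClass ν] {τ : ℝ} (h0 : 0 < τ)
    (h1 : τ < 1) : cdf ν (quantile ν τ) = τ := by
  refine le_antisymm ?_ ((quantile_le_iff ν h0 h1 _).1 le_rfl)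
  have hl : Function.leftLim (cdf ν) (quantile ν τ) = cdf ν (quantile ν τ) := by
    have h := (cdf ν).measure_singleton (quantile ν τ)
    rw [measure_cdf, measure_singleton] at h
    have h2 := ENNReal.ofReal_eq_zero.1 h.symm
    have h3 := (monotone_cdf ν).leftLim_le (le_refl (quantile ν τ))
    linarith
  rw [← hl]
  refine le_of_tendsto ((monotone_cdf ν).tendsto_leftLim _)
    (eventually_nhdsWithin_of_forall fun z hz => ?_)
  by_contra! hlt
  exact absurd ((quantile_le_iff ν h0 h1 z).2 hlt.le) (not_le.2 hz)

theorem quantile_mono (ν : Measure ℝ) {s t : ℝ} (h0 : 0 < s) (hst : s ≤ t) (h1 : t < 1) :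
    quantile ν s ≤ quantile ν t :=
  (quantile_le_iff ν h0 (hst.trans_lt h1) _).2
    (hst.trans ((quantile_le_iff ν (h0.trans_le hst) h1 _).1 le_rfl))

instance isProbabilityMeasure_unifLaw : IsProbabilityMeasure unifLaw :=
  ⟨by simp [unifLaw]⟩

/-- The quantile transform of a uniform variable. -/
theorem map_unifLaw_eq (ν : Measure ℝ) [IsProbabilityMeasure ν] {Y : ℝ → ℝ} (hY : Measurable Y)
    (h : ∀ u ∈ Ioo (0 : ℝ) 1, Y u = quantile ν u) : unifLaw.map Y = ν := by
  have := Measure.isProbabilityMeasure_map (μ := unifLaw) hY.aemeasurable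
  refine Measure.ext_of_Iic _ _ fun y => ?_
  rw [Measure.map_apply hY measurableSet_Iic, ← ofReal_cdf ν y, unifLaw,
    Measure.restrict_apply (hY measurableSet_Iic)]
  have hset : Y ⁻¹' Iic y ∩ Ioo 0 1 = Iic (cdf ν y) ∩ Ioo 0 1 := by
    ext u
    simp only [mem_inter_iff, mem_preimage, mem_Iic, and_congr_left_iff]
    intro hu
    rw [h u hu, quantile_le_iff ν hu.1 hu.2]
  rw [hset]
  refine le_antisymm ?_ ?_
  · calc volume (Iic (cdf ν y) ∩ Ioo 0 1) ≤ volume (Ioc 0 (cdf ν y)) :=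
          measure_mono fun u hu => ⟨hu.2.1, hu.1⟩
      _ = _ := by simp
  · calc ENNReal.ofReal (cdf ν y) = volume (Ioo 0 (cdf ν y)) := by simp
      _ ≤ volume (Iic (cdf ν y) ∩ Ioo 0 1) := measure_mono fun u (hu : u ∈ Ioo 0 (cdf ν y)) =>
          ⟨hu.2.le, hu.1, hu.2.trans_le (cdf_le_one ν y)⟩

/-- If a density is at least `c` at the quantiles of levels in `[s, t]`, then the quantile function
has slope at most `1 / c` there. -/
theorem mul_quantile_sub_le (ν : Measure ℝ) [IsProbabilityMeasure ν] {f : ℝ → ℝ}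
    (hν : ν = volume.withDensity fun y => ENNReal.ofReal (f y)) {c s t : ℝ} (h0 : 0 < s)
    (hst : s ≤ t) (h1 : t < 1) (hcont : ContinuousOn (quantile ν) (Icc s t))
    (hc : ∀ r ∈ Icc s t, c ≤ f (quantile ν r)) :
    c * (quantile ν t - quantile ν s) ≤ t - s := by
  have : NullSingletonClass ν := by rw [hν]; infer_instance
  have hQ := quantile_mono ν h0 hst h1
  have hm : ν (Ioc (quantile ν s) (quantile ν t)) = ENNReal.ofReal (t - s) := by
    have hI := (cdf ν).measure_Ioc (quantile ν s) (quantile ν t)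
    rw [measure_cdf] at hI
    rw [hI, cdf_quantile ν (h0.trans_le hst) h1,
      cdf_quantile ν h0 (hst.trans_lt h1)]
  have hle : ENNReal.ofReal (c * (quantile ν t - quantile ν s)) ≤ ENNReal.ofReal (t - s) := by
    rw [← hm]
    have hd : ν (Ioc (quantile ν s) (quantile ν t)) =
        ∫⁻ y in Ioc (quantile ν s) (quantile ν t), ENNReal.ofReal (f y) := by
      rw [← withDensity_apply _ measurableSet_Ioc, ← hν]
    rw [hd, ENNReal.ofReal_mul' (sub_nonneg.2 hQ),
      ← Real.volume_Ioc, ← setLIntegral_const]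
    refine setLIntegral_mono' measurableSet_Ioc fun y hy => ?_
    -- The density is bounded below only at quantiles; continuity of the quantile function makes
    -- every point of the interval a quantile.
    obtain ⟨r, hr, rfl⟩ := intermediate_value_Icc hst hcont (Ioc_subset_Icc_self hy)
    exact ENNReal.ofReal_le_ofReal (hc r hr)
  exact (ENNReal.ofReal_le_ofReal_iff (sub_nonneg.2 hst)).1 hle

/-- Uniform absolute continuity: short intervals have small probability. -/
theorem exists_measure_Icc_le (ν : Measure ℝ) [IsFiniteMeasure ν] (hν : ν ≪ volume)
    {δ : ℝ≥0∞} (hδ : δ ≠ 0) :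
    ∃ ε₀ > 0, ∀ ε ≤ ε₀, ∀ t : ℝ, ν (Icc (t - ε) (t + ε)) ≤ δ := by
  obtain ⟨η, hη, hlt⟩ := exists_pos_setLIntegral_lt_of_measure_lt
    (μ := (volume : Measure ℝ)) (f := ν.rnDeriv volume)
    (Measure.lintegral_rnDeriv_lt_top ν volume).ne hδ
  obtain ⟨r, hr, hrη⟩ : ∃ r : ℝ, 0 < r ∧ ENNReal.ofReal r < η := by
    obtain ⟨r, hr0, hr⟩ := ENNReal.lt_iff_exists_nnreal_btwn.1 hη
    exact ⟨r, by exact_mod_cast hr0, by simpa using hr⟩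
  refine ⟨r / 2, half_pos hr, fun ε hε t => ?_⟩
  rw [← Measure.setLIntegral_rnDeriv hν]
  refine (hlt _ (lt_of_le_of_lt ?_ hrη)).le
  rw [Real.volume_Icc]
  exact ENNReal.ofReal_le_ofReal (by linarith)

/-! ### Pinball loss and the deterministic consistency step. -/

/-- In this form the loss is `|u| / 2` plus a linear term, so convexity and the increment bound
reduce to the triangle inequality. -/
theorem pinball_eq (τ u : ℝ) : pinball τ u = |u| / 2 + (τ - 1 / 2) * u := by
  unfold pinball
  split_ifs with h
  · rw [abs_of_nonpos h]; ring
  · rw [abs_of_pos (not_le.1 h)]; ring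

theorem pinball_convex_comb (τ : ℝ) {t : ℝ} (h0 : 0 ≤ t) (h1 : t ≤ 1) (u v : ℝ) :
    pinball τ ((1 - t) * u + t * v) ≤ (1 - t) * pinball τ u + t * pinball τ v := by
  simp only [pinball_eq]
  have h := abs_add_le ((1 - t) * u) (t * v)
  rw [abs_mul, abs_mul, abs_of_nonneg h0, abs_of_nonneg (sub_nonneg.2 h1)] at h
  linarith

/-- The increment of the pinball loss dominates a linear function with random slope, plus a
multiple of `|w|` when the residual is small. -/
theorem pinball_increment_ge {τ y q w lo hi h : ℝ} (hlo : lo ≤ q)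
    (hhi : q ≤ hi) (hlo' : q - h ≤ lo) (hhi' : hi ≤ q + h) :
    w * (((Iic lo).indicator 1 y + (Iic hi).indicator 1 y) / 2 - τ) +
      ((Iic hi).indicator 1 y - (Iic lo).indicator 1 y) * (|w| / 2 - h) ≤
      pinball τ (y - (q + w)) - pinball τ (y - q) := by
  simp only [pinball_eq]
  rcases le_or_gt y lo with hy | hy
  · rw [indicator_of_mem (by exact hy), indicator_of_mem (by exact hy.trans (hlo.trans hhi))]
    have e1 : |y - q| = -(y - q) := abs_of_nonpos (by linarith)
    have e2 := neg_abs_le (y - (q + w))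
    simp only [Pi.one_apply]
    rw [e1]
    linarith
  rcases le_or_gt y hi with hy2 | hy2
  · rw [indicator_of_notMem (by simpa using hy), indicator_of_mem (by exact hy2)]
    have e1 : |y - q| ≤ h := abs_le.2 ⟨by linarith, by linarith⟩
    have e2 := abs_sub_abs_le_abs_sub w (y - q)
    have e3 : |y - (q + w)| = |w - (y - q)| := by rw [← abs_neg]; congr 1; ring
    simp only [Pi.one_apply]
    rw [e3]
    linarith
  · rw [indicator_of_notMem (by simpa using hy), indicator_of_notMem (by simpa using hy2)]
    have e1 : |y - q| = y - q := abs_of_nonneg (by linarith)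
    have e2 := le_abs_self (y - (q + w))
    rw [e1]
    linarith

/-- If the regression estimate is at distance at least `r` from `b₀`, then by convexity the
objective is not larger than at `b₀` somewhere on the sphere of radius `r` around `b₀`. -/
theorem IsQuantileRegression.exists_sphere_le {p n : ℕ} {xs : ℕ → EuclideanSpace ℝ (Fin p)}
    {ys : ℕ → ℝ} {τ r : ℝ} {b b₀ : EuclideanSpace ℝ (Fin p)}
    (hb : IsQuantileRegression n xs ys τ b) (hr : 0 < r) (hbr : r ≤ ‖b - b₀‖) :
    ∃ v : EuclideanSpace ℝ (Fin p), ‖v‖ = r ∧ ∑ i ∈ Finset.range n,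
      (pinball τ (ys i - (inner ℝ b₀ (xs i) + inner ℝ v (xs i))) -
        pinball τ (ys i - inner ℝ b₀ (xs i))) ≤ 0 := by
  have hd : 0 < ‖b - b₀‖ := hr.trans_le hbr
  set t : ℝ := r / ‖b - b₀‖
  have ht0 : 0 ≤ t := by positivity
  have ht1 : t ≤ 1 := (div_le_one hd).2 hbr
  refine ⟨t • (b - b₀), ?_, ?_⟩
  · rw [norm_smul, Real.norm_of_nonneg ht0, div_mul_cancel₀ _ hd.ne']
  · have hsum : ∀ i ∈ Finset.range n,
        pinball τ (ys i - (inner ℝ b₀ (xs i) + inner ℝ (t • (b - b₀)) (xs i))) -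
          pinball τ (ys i - inner ℝ b₀ (xs i)) ≤
        t * (pinball τ (ys i - inner ℝ b (xs i)) - pinball τ (ys i - inner ℝ b₀ (xs i))) := by
      intro i _
      have h := pinball_convex_comb τ ht0 ht1 (ys i - inner ℝ b₀ (xs i))
        (ys i - inner ℝ b (xs i))
      have e : ys i - (inner ℝ b₀ (xs i) + inner ℝ (t • (b - b₀)) (xs i)) =
          (1 - t) * (ys i - inner ℝ b₀ (xs i)) + t * (ys i - inner ℝ b (xs i)) := by
        rw [real_inner_smul_left, inner_sub_left]; ring
      rw [e]
      linarith
    refine (Finset.sum_le_sum hsum).trans ?_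
    rw [← Finset.mul_sum, Finset.sum_sub_distrib]
    exact mul_nonpos_of_nonneg_of_nonpos ht0 (sub_nonpos.2 (hb b₀))

/-- Deterministic step of the consistency proof: if the score vector and the random Gram matrix are
close to their means, the regression estimate is close to `b₀`. -/
theorem IsQuantileRegression.norm_sub_lt {p n : ℕ} {xs : ℕ → EuclideanSpace ℝ (Fin p)}
    {ys : ℕ → ℝ} {τ r κ c η lam T : ℝ} {b b₀ : EuclideanSpace ℝ (Fin p)} {lo hi : ℕ → ℝ}
    (hb : IsQuantileRegression n xs ys τ b) (hn : 0 < n) (hr : 0 < r) (hκ : 0 < κ) (hc : 0 < c)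
    (hlo : ∀ i, i < n → lo i ≤ inner ℝ b₀ (xs i)) (hhi : ∀ i, i < n → inner ℝ b₀ (xs i) ≤ hi i)
    (hlo' : ∀ i, i < n → inner ℝ b₀ (xs i) - κ * r * ‖xs i‖ / c ≤ lo i)
    (hhi' : ∀ i, i < n → hi i ≤ inner ℝ b₀ (xs i) + κ * r * ‖xs i‖ / c)
    (hlam : ∀ v : EuclideanSpace ℝ (Fin p),
      lam * n * ‖v‖ ^ 2 ≤ ∑ i ∈ Finset.range n, inner ℝ v (xs i) ^ 2)
    (hT : ∑ i ∈ Finset.range n, ‖xs i‖ ^ 2 ≤ T * n)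
    (hη : p * η + κ * (2 * κ * T / c + η * p ^ 2 + 2 * κ * η * p / c) < κ * lam)
    (hscore : ∀ j : Fin p, |∑ i ∈ Finset.range n, xs i j *
      (((Iic (lo i)).indicator 1 (ys i) + (Iic (hi i)).indicator 1 (ys i)) / 2 - τ)| ≤ η * r * n)
    (hgram : ∀ j k : Fin p, |∑ i ∈ Finset.range n, (xs i j * xs i k / (2 * (κ * r * ‖xs i‖)) *
      ((Iic (hi i)).indicator 1 (ys i) - (Iic (lo i)).indicator 1 (ys i)) - xs i j * xs i k)| ≤
        η * n) :
    ‖b - b₀‖ < r := by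
  by_contra! hbr
  obtain ⟨v, hv, hZ⟩ := hb.exists_sphere_le hr hbr
  set J : ℕ → ℝ := fun i => (Iic (hi i)).indicator 1 (ys i) - (Iic (lo i)).indicator 1 (ys i)
    with hJ
  set ψ : ℕ → ℝ := fun i =>
    ((Iic (lo i)).indicator 1 (ys i) + (Iic (hi i)).indicator 1 (ys i)) / 2 - τ with hψ
  have hin : ∀ i, inner ℝ v (xs i) = ∑ j, v j * xs i j := by
    intro i; rw [PiLp.inner_apply]; simp [mul_comm]
  have hinsq : ∀ i, inner ℝ v (xs i) ^ 2 = ∑ j, ∑ k, v j * v k * (xs i j * xs i k) := by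
    intro i
    rw [hin, sq, Finset.sum_mul_sum]
    exact Finset.sum_congr rfl fun j _ => Finset.sum_congr rfl fun k _ => by ring
  have hnorm : ∀ i, ‖xs i‖ ^ 2 = ∑ j, xs i j * xs i j := by
    intro i; rw [EuclideanSpace.norm_sq_eq]; simp [sq]
  have hJ0 : ∀ i, i < n → 0 ≤ J i := by
    intro i hi'
    have : (Iic (lo i)).indicator (1 : ℝ → ℝ) (ys i) ≤ (Iic (hi i)).indicator 1 (ys i) :=
      indicator_le_indicator_of_subset (Iic_subset_Iic.2 ((hlo i hi').trans (hhi i hi')))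
        (fun _ => zero_le_one) _
    simp only [hJ]; linarith
  have hterm : ∀ i ∈ Finset.range n,
      inner ℝ v (xs i) * ψ i + κ * (J i / (2 * (κ * r * ‖xs i‖))) *
        (inner ℝ v (xs i) ^ 2 - 2 * κ / c * r ^ 2 * ‖xs i‖ ^ 2) ≤
      pinball τ (ys i - (inner ℝ b₀ (xs i) + inner ℝ v (xs i))) -
        pinball τ (ys i - inner ℝ b₀ (xs i)) := by
    intro i hi'
    rw [Finset.mem_range] at hi'
    have h := pinball_increment_ge (y := ys i) (τ := τ) (w := inner ℝ v (xs i)) (hlo i hi')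
      (hhi i hi') (hlo' i hi') (hhi' i hi')
    refine le_trans ?_ h
    refine add_le_add le_rfl ?_
    -- Cauchy–Schwarz on the sphere trades `|w|` for the smaller `w ^ 2 / (r * ‖xs i‖)`, which turns
    -- the window term into a quadratic form in `v`. A zero design point contributes nothing on
    -- either side, division by zero being `0`.
    have hcs : |inner ℝ v (xs i)| ≤ r * ‖xs i‖ := hv ▸ abs_real_inner_le_norm v (xs i)
    rcases (norm_nonneg (xs i)).eq_or_lt with hx | hx
    · rw [← hx] at hcs ⊢
      have : inner ℝ v (xs i) = 0 := by
        rw [← abs_eq_zero]; exact le_antisymm (by simpa using hcs) (abs_nonneg _)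
      simp [this]
    · have e : κ * (J i / (2 * (κ * r * ‖xs i‖))) *
          (inner ℝ v (xs i) ^ 2 - 2 * κ / c * r ^ 2 * ‖xs i‖ ^ 2) =
          J i * (|inner ℝ v (xs i)| ^ 2 / (r * ‖xs i‖) / 2 - κ * r * ‖xs i‖ / c) := by
        rw [sq_abs]; field_simp
      rw [e]
      refine mul_le_mul_of_nonneg_left ?_ (hJ0 i hi')
      have : |inner ℝ v (xs i)| ^ 2 / (r * ‖xs i‖) ≤ |inner ℝ v (xs i)| := by
        rw [div_le_iff₀ (by positivity), sq]
        exact mul_le_mul_of_nonneg_left hcs (abs_nonneg _)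
      linarith
  have hmain := (Finset.sum_le_sum hterm).trans hZ
  set Ξ : Fin p → ℝ := fun j => ∑ i ∈ Finset.range n, xs i j * ψ i with hΞ
  set G : Fin p → Fin p → ℝ := fun j k => ∑ i ∈ Finset.range n,
    (xs i j * xs i k / (2 * (κ * r * ‖xs i‖)) * J i - xs i j * xs i k) with hG
  have s1 : ∑ i ∈ Finset.range n, inner ℝ v (xs i) * ψ i = ∑ j, v j * Ξ j := by
    simp only [hin, hΞ, Finset.sum_mul, Finset.mul_sum]
    rw [Finset.sum_comm]
    exact Finset.sum_congr rfl fun j _ => Finset.sum_congr rfl fun i _ => by ring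
  have s2 : ∑ i ∈ Finset.range n, (J i / (2 * (κ * r * ‖xs i‖)) - 1) * inner ℝ v (xs i) ^ 2 =
      ∑ j, ∑ k, v j * v k * G j k := by
    simp only [hinsq, hG, Finset.mul_sum]
    rw [Finset.sum_comm]
    refine Finset.sum_congr rfl fun j _ => ?_
    rw [Finset.sum_comm]
    exact Finset.sum_congr rfl fun k _ => Finset.sum_congr rfl fun i _ => by ring
  have s3 : ∑ i ∈ Finset.range n, (J i / (2 * (κ * r * ‖xs i‖)) - 1) * ‖xs i‖ ^ 2 =
      ∑ j, G j j := by
    simp only [hnorm, hG, Finset.mul_sum]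
    rw [Finset.sum_comm]
    exact Finset.sum_congr rfl fun j _ => Finset.sum_congr rfl fun i _ => by ring
  -- The lower bound splits into the score term, the true Gram form and trace, and the errors `G` of
  -- the reweighted Gram matrix. After division by `n * r ^ 2`, `hη` says that the Gram form
  -- outweighs the rest.
  have s4 : ∑ i ∈ Finset.range n, (inner ℝ v (xs i) * ψ i + κ * (J i / (2 * (κ * r * ‖xs i‖))) *
        (inner ℝ v (xs i) ^ 2 - 2 * κ / c * r ^ 2 * ‖xs i‖ ^ 2)) =
      ∑ j, v j * Ξ j + κ * ((∑ i ∈ Finset.range n, inner ℝ v (xs i) ^ 2) -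
        2 * κ / c * r ^ 2 * (∑ i ∈ Finset.range n, ‖xs i‖ ^ 2) +
        (∑ j, ∑ k, v j * v k * G j k) - 2 * κ / c * r ^ 2 * ∑ j, G j j) := by
    rw [← s1, ← s2, ← s3]
    simp only [Finset.mul_sum, ← Finset.sum_add_distrib, ← Finset.sum_sub_distrib]
    exact Finset.sum_congr rfl fun i _ => by ring
  rw [s4] at hmain
  have hvj : ∀ j, |v j| ≤ r := fun j => hv ▸ PiLp.norm_apply_le v j
  have hn' : (0 : ℝ) < n := by exact_mod_cast hn
  have b1 : -(p * (r * (η * r * n))) ≤ ∑ j, v j * Ξ j := by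
    have : ∑ _j : Fin p, -(r * (η * r * n)) ≤ ∑ j, v j * Ξ j := by
      refine Finset.sum_le_sum fun j _ => ?_
      refine (neg_le_neg ?_).trans (neg_abs_le _)
      rw [abs_mul]
      exact mul_le_mul (hvj j) (hscore j) (abs_nonneg _) hr.le
    simpa using this
  have b2 : -(p * (p * (r * r * (η * n)))) ≤ ∑ j, ∑ k, v j * v k * G j k := by
    have : ∑ _j : Fin p, ∑ _k : Fin p, -(r * r * (η * n)) ≤ ∑ j, ∑ k, v j * v k * G j k := by
      refine Finset.sum_le_sum fun j _ => Finset.sum_le_sum fun k _ => ?_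
      refine (neg_le_neg ?_).trans (neg_abs_le _)
      rw [abs_mul, abs_mul]
      exact mul_le_mul (mul_le_mul (hvj j) (hvj k) (abs_nonneg _) hr.le) (hgram j k)
        (abs_nonneg _) (by positivity)
    simpa using this
  have b3 : ∑ j, G j j ≤ p * (η * n) := by
    have : ∑ j, G j j ≤ ∑ _j : Fin p, η * n :=
      Finset.sum_le_sum fun j _ => (le_abs_self _).trans (hgram j j)
    simpa using this
  have b4 := hlam v
  rw [hv] at b4
  have hK : 0 ≤ 2 * κ / c * r ^ 2 := by positivity
  have b5 := mul_le_mul_of_nonneg_left hT hK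
  have b6 := mul_le_mul_of_nonneg_left b3 hK
  have b7 : κ * (lam * n * r ^ 2 - 2 * κ / c * r ^ 2 * (T * n) - p * (p * (r * r * (η * n))) -
      2 * κ / c * r ^ 2 * (p * (η * n))) ≤ κ * ((∑ i ∈ Finset.range n, inner ℝ v (xs i) ^ 2) -
        2 * κ / c * r ^ 2 * (∑ i ∈ Finset.range n, ‖xs i‖ ^ 2) +
        (∑ j, ∑ k, v j * v k * G j k) - 2 * κ / c * r ^ 2 * ∑ j, G j j) :=
    mul_le_mul_of_nonneg_left (by linarith) hκ.le
  have hpos : 0 < (n : ℝ) * r ^ 2 := by positivity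
  have b8 := mul_lt_mul_of_pos_right hη hpos
  have e8 : (p * η + κ * (2 * κ * T / c + η * p ^ 2 + 2 * κ * η * p / c)) * (n * r ^ 2) =
      κ * lam * (n * r ^ 2) + p * (r * (η * r * n)) - κ * (lam * n * r ^ 2 -
        2 * κ / c * r ^ 2 * (T * n) - p * (p * (r * r * (η * n))) -
      2 * κ / c * r ^ 2 * (p * (η * n))) := by ring
  linarith

/-! ### Probability bounds for the score and the Gram matrix. -/

/-- Chebyshev's inequality for a sum of bounded functions of independent variables. -/
theorem measure_le_abs_sum_sub_le {Ω : Type*} [MeasurableSpace Ω] {P : Measure Ω}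
    [IsProbabilityMeasure P] {ys : ℕ → Ω → ℝ} (hys : ∀ i, Measurable (ys i))
    (hindep : iIndepFun ys P) {ψ : ℕ → ℝ → ℝ} (hψ : ∀ i, Measurable (ψ i))
    {C e V : ℕ → ℝ} (hC : ∀ i y, |ψ i y| ≤ C i) {n : ℕ} {S t : ℝ} (ht : 0 < t)
    (he : ∀ i, i < n → ∫ ω, ψ i (ys i ω) ∂P = e i)
    (hV : ∀ i, i < n → ∫ ω, ψ i (ys i ω) ^ 2 ∂P ≤ V i) (hS : ∑ i ∈ Finset.range n, V i ≤ S) :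
    P {ω | t ≤ |∑ i ∈ Finset.range n, (ψ i (ys i ω) - e i)|} ≤ ENNReal.ofReal (S / t ^ 2) := by
  have hm : ∀ i, Measurable fun ω => ψ i (ys i ω) := fun i => (hψ i).comp (hys i)
  have hL : ∀ i, MemLp (fun ω => ψ i (ys i ω)) 2 P := fun i =>
    MemLp.of_bound (hm i).aestronglyMeasurable (C i) (Eventually.of_forall fun ω => hC i _)
  have hint : ∫ ω, ∑ i ∈ Finset.range n, ψ i (ys i ω) ∂P = ∑ i ∈ Finset.range n, e i := by
    rw [integral_finsetSum _ fun i _ => (hL i).integrable (by norm_num)]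
    exact Finset.sum_congr rfl fun i hi => he i (Finset.mem_range.1 hi)
  have hsumL : MemLp (∑ i ∈ Finset.range n, fun ω => ψ i (ys i ω)) 2 P :=
    memLp_finsetSum' _ fun i _ => hL i
  have hcheb := meas_ge_le_variance_div_sq hsumL ht
  have hvar : variance (∑ i ∈ Finset.range n, fun ω => ψ i (ys i ω)) P ≤ S := by
    rw [IndepFun.variance_sum (fun i _ => hL i)]
    · refine (Finset.sum_le_sum fun i hi => ?_).trans hS
      refine (variance_le_expectation_sq (hm i).aestronglyMeasurable).trans ?_
      simpa using hV i (Finset.mem_range.1 hi)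
    · intro i _ j _ hij
      exact (hindep.indepFun hij).comp (hψ i) (hψ j)
  refine le_trans (le_of_eq ?_) (hcheb.trans (ENNReal.ofReal_le_ofReal ?_))
  · congr 1
    ext ω
    simp only [Finset.sum_apply, hint, Finset.sum_sub_distrib, mem_ofPred_eq]
  · gcongr

theorem integral_indicator_Iic_comp {Ω : Type*} [MeasurableSpace Ω] {P : Measure Ω}
    [IsProbabilityMeasure P] {Y : Ω → ℝ} (hY : Measurable Y) (z : ℝ) :
    ∫ ω, (Iic z).indicator (1 : ℝ → ℝ) (Y ω) ∂P = cdf (P.map Y) z := by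
  have := Measure.isProbabilityMeasure_map (μ := P) hY.aemeasurable
  rw [cdf_eq_real, ← integral_map (φ := Y) (f := (Iic z).indicator (1 : ℝ → ℝ)) hY.aemeasurable
    (measurable_one.indicator measurableSet_Iic).aestronglyMeasurable,
    integral_indicator_one measurableSet_Iic]

theorem measurable_indicator_Iic (z : ℝ) : Measurable ((Iic z).indicator (1 : ℝ → ℝ)) :=
  measurable_one.indicator measurableSet_Iic

theorem integrable_indicator_Iic_comp {Ω : Type*} [MeasurableSpace Ω] {P : Measure Ω}
    [IsProbabilityMeasure P] {Y : Ω → ℝ} (hY : Measurable Y) (z : ℝ) :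
    Integrable (fun ω => (Iic z).indicator (1 : ℝ → ℝ) (Y ω)) P := by
  refine Integrable.of_bound ((measurable_indicator_Iic z).comp hY).aestronglyMeasurable 1
    (Eventually.of_forall fun ω => ?_)
  by_cases h : Y ω ∈ Iic z <;> simp [indicator, h]

/-- Finite-sample bound for the probability that a quantile regression estimate is off by at least
`r`. -/
theorem measure_le_norm_sub_le {p n : ℕ} {Ω : Type*} [MeasurableSpace Ω] {P : Measure Ω}
    [IsProbabilityMeasure P] {xs : ℕ → EuclideanSpace ℝ (Fin p)} {ys : ℕ → Ω → ℝ}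
    (hys : ∀ i, Measurable (ys i)) (hindep : iIndepFun ys P)
    {τ r κ c η lam T M : ℝ} {b : Ω → EuclideanSpace ℝ (Fin p)} {b₀ : EuclideanSpace ℝ (Fin p)}
    {lo hi : ℕ → ℝ} (hb : ∀ ω, IsQuantileRegression n xs (fun i => ys i ω) τ (b ω))
    (hn : 0 < n) (hr : 0 < r) (hκ : 0 < κ) (hc : 0 < c) (hη0 : 0 < η)
    (h0 : 0 ≤ τ) (h1 : τ ≤ 1)
    (hcdflo : ∀ i, i < n → cdf (P.map (ys i)) (lo i) = τ - κ * r * ‖xs i‖)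
    (hcdfhi : ∀ i, i < n → cdf (P.map (ys i)) (hi i) = τ + κ * r * ‖xs i‖)
    (hlo : ∀ i, i < n → lo i ≤ inner ℝ b₀ (xs i)) (hhi : ∀ i, i < n → inner ℝ b₀ (xs i) ≤ hi i)
    (hlo' : ∀ i, i < n → inner ℝ b₀ (xs i) - κ * r * ‖xs i‖ / c ≤ lo i)
    (hhi' : ∀ i, i < n → hi i ≤ inner ℝ b₀ (xs i) + κ * r * ‖xs i‖ / c)
    (hlam : ∀ v : EuclideanSpace ℝ (Fin p),
      lam * n * ‖v‖ ^ 2 ≤ ∑ i ∈ Finset.range n, inner ℝ v (xs i) ^ 2)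
    (hT : ∑ i ∈ Finset.range n, ‖xs i‖ ^ 2 ≤ T * n) (hM : ∀ i, i < n → ‖xs i‖ ≤ M)
    (hη : p * η + κ * (2 * κ * T / c + η * p ^ 2 + 2 * κ * η * p / c) < κ * lam) :
    P {ω | r ≤ ‖b ω - b₀‖} ≤ p * ENNReal.ofReal (T * n / (η * r * n) ^ 2) +
      p * (p * ENNReal.ofReal (M / (2 * κ * r) * (T * n) / (η * n) ^ 2)) := by
  have hn' : (0 : ℝ) < n := by exact_mod_cast hn
  set A : Fin p → Set Ω := fun j => {ω | η * r * n ≤ |∑ i ∈ Finset.range n, (xs i j *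
    (((Iic (lo i)).indicator 1 (ys i ω) + (Iic (hi i)).indicator 1 (ys i ω)) / 2 - τ) - 0)|}
    with hA
  set B : Fin p → Fin p → Set Ω := fun j k => {ω | η * n ≤ |∑ i ∈ Finset.range n,
    (xs i j * xs i k / (2 * (κ * r * ‖xs i‖)) *
      ((Iic (hi i)).indicator 1 (ys i ω) - (Iic (lo i)).indicator 1 (ys i ω)) -
      xs i j * xs i k)|} with hB
  have hind : ∀ z y : ℝ, 0 ≤ (Iic z).indicator (1 : ℝ → ℝ) y ∧
      (Iic z).indicator (1 : ℝ → ℝ) y ≤ 1 := fun z y => by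
    by_cases h : y ∈ Iic z <;> simp [indicator, h]
  have hcoord : ∀ i j, xs i j ^ 2 ≤ ‖xs i‖ ^ 2 := fun i j => by
    rw [← sq_abs]
    have := PiLp.norm_apply_le (xs i) j
    rw [Real.norm_eq_abs] at this
    gcongr
  -- Outside finitely many bad events, one for each score coordinate and each Gram entry, the
  -- deterministic step applies.
  have hsub : {ω | r ≤ ‖b ω - b₀‖} ⊆ (⋃ j, A j) ∪ ⋃ j, ⋃ k, B j k := by
    intro ω hω
    by_contra hnot
    simp only [mem_union, mem_iUnion, not_or, not_exists] at hnot
    refine absurd ((hb ω).norm_sub_lt hn hr hκ hc hlo hhi hlo' hhi' hlam hT hη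
      (fun j => ?_) (fun j k => ?_)) (not_lt.2 hω)
    · have := hnot.1 j
      simp only [hA, mem_ofPred_eq, not_le, sub_zero] at this
      exact this.le
    · have := hnot.2 j k
      simp only [hB, mem_ofPred_eq, not_le] at this
      exact this.le
  have hAle : ∀ j, P (A j) ≤ ENNReal.ofReal (T * n / (η * r * n) ^ 2) := by
    intro j
    refine measure_le_abs_sum_sub_le hys hindep (ψ := fun i y => xs i j *
      (((Iic (lo i)).indicator 1 y + (Iic (hi i)).indicator 1 y) / 2 - τ)) (e := fun _ => 0)
      (C := fun i => |xs i j|) (V := fun i => ‖xs i‖ ^ 2) (fun i => ?_) (fun i y => ?_)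
      (by positivity) (fun i hi' => ?_) (fun i hi' => ?_) hT
    · exact ((((measurable_indicator_Iic _).add (measurable_indicator_Iic _)).div_const _).sub_const
        _).const_mul _
    · have h2 := hind (lo i) y
      have h3 := hind (hi i) y
      rw [abs_mul]
      refine mul_le_of_le_one_right (abs_nonneg _) (abs_le.2 ⟨by linarith, by linarith⟩)
    -- The window levels are symmetric about `τ`, so the score has mean exactly zero.
    · have i1 := integrable_indicator_Iic_comp (P := P) (hys i) (lo i)
      have i2 := integrable_indicator_Iic_comp (P := P) (hys i) (hi i)
      have i3 : Integrable (fun ω => ((Iic (lo i)).indicator (1 : ℝ → ℝ) (ys i ω) +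
          (Iic (hi i)).indicator 1 (ys i ω)) / 2) P := (i1.add i2).div_const 2
      rw [integral_const_mul, integral_sub i3 (integrable_const _),
        integral_div, integral_add i1 i2, integral_indicator_Iic_comp (hys i),
        integral_indicator_Iic_comp (hys i), hcdflo i hi', hcdfhi i hi']
      simp
    · calc ∫ ω, (xs i j * (((Iic (lo i)).indicator 1 (ys i ω) +
            (Iic (hi i)).indicator 1 (ys i ω)) / 2 - τ)) ^ 2 ∂P
          ≤ ∫ _ω, ‖xs i‖ ^ 2 ∂P := by
            refine integral_mono_of_nonneg (Eventually.of_forall fun ω => sq_nonneg _)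
              (integrable_const _) (Eventually.of_forall fun ω => ?_)
            have h2 := hind (lo i) (ys i ω)
            have h3 := hind (hi i) (ys i ω)
            simp only [mul_pow]
            refine (mul_le_of_le_one_right (sq_nonneg _) ?_).trans (hcoord i j)
            rw [sq_le_one_iff_abs_le_one]
            exact abs_le.2 ⟨by linarith, by linarith⟩
        _ = _ := by simp
  have hBle : ∀ j k, P (B j k) ≤ ENNReal.ofReal (M / (2 * κ * r) * (T * n) / (η * n) ^ 2) := by
    intro j k
    refine measure_le_abs_sum_sub_le hys hindep (ψ := fun i y =>
      xs i j * xs i k / (2 * (κ * r * ‖xs i‖)) *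
      ((Iic (hi i)).indicator 1 y - (Iic (lo i)).indicator 1 y)) (e := fun i => xs i j * xs i k)
      (C := fun i => |xs i j * xs i k / (2 * (κ * r * ‖xs i‖))|)
      (V := fun i => M / (2 * κ * r) * ‖xs i‖ ^ 2) (fun i => ?_) (fun i y => ?_)
      (by positivity) (fun i hi' => ?_) (fun i hi' => ?_) ?_
    · exact ((measurable_indicator_Iic _).sub (measurable_indicator_Iic _)).const_mul _
    · have h2 := hind (lo i) y
      have h3 := hind (hi i) y
      rw [abs_mul]
      refine mul_le_of_le_one_right (abs_nonneg _) (abs_le.2 ⟨by linarith, by linarith⟩)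
    -- The window has probability `2 * κ * r * ‖xs i‖`, which cancels the normalisation.
    · have i1 := integrable_indicator_Iic_comp (P := P) (hys i) (lo i)
      have i2 := integrable_indicator_Iic_comp (P := P) (hys i) (hi i)
      rw [integral_const_mul, integral_sub i2 i1, integral_indicator_Iic_comp (hys i),
        integral_indicator_Iic_comp (hys i), hcdflo i hi', hcdfhi i hi']
      rcases (norm_nonneg (xs i)).eq_or_lt with hx | hx
      · have : xs i = 0 := norm_eq_zero.1 hx.symm
        simp [this]
      · field_simp; ring
    · have i1 := integrable_indicator_Iic_comp (P := P) (hys i) (lo i)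
      have i2 := integrable_indicator_Iic_comp (P := P) (hys i) (hi i)
      -- A difference of nested indicators is an indicator, hence its own square. The second moment
      -- is thus at most `‖xs i‖ ^ 3 / (2 * κ * r)`, and one factor `‖xs i‖` is bounded by `M`.
      have hsq : ∀ ω, (xs i j * xs i k / (2 * (κ * r * ‖xs i‖)) *
          ((Iic (hi i)).indicator 1 (ys i ω) - (Iic (lo i)).indicator 1 (ys i ω))) ^ 2 =
          (xs i j * xs i k / (2 * (κ * r * ‖xs i‖))) ^ 2 *
          ((Iic (hi i)).indicator 1 (ys i ω) - (Iic (lo i)).indicator 1 (ys i ω)) := by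
        intro ω
        rw [mul_pow]
        congr 1
        have hlh : lo i ≤ hi i := (hlo i hi').trans (hhi i hi')
        by_cases h2 : ys i ω ≤ lo i
        · have h3 := h2.trans hlh
          simp [indicator, h2, h3]
        · by_cases h3 : ys i ω ≤ hi i <;> simp [indicator, h2, h3]
      simp only [hsq]
      rw [integral_const_mul, integral_sub i2 i1, integral_indicator_Iic_comp (hys i),
        integral_indicator_Iic_comp (hys i), hcdflo i hi', hcdfhi i hi']
      rcases (norm_nonneg (xs i)).eq_or_lt with hx | hx
      · simp [← hx]
      · have e : (xs i j * xs i k / (2 * (κ * r * ‖xs i‖))) ^ 2 *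
            (τ + κ * r * ‖xs i‖ - (τ - κ * r * ‖xs i‖)) =
            xs i j ^ 2 * xs i k ^ 2 / (2 * κ * r * ‖xs i‖) := by field_simp; ring
        rw [e, div_le_iff₀ (by positivity)]
        calc xs i j ^ 2 * xs i k ^ 2 ≤ ‖xs i‖ ^ 2 * ‖xs i‖ ^ 2 :=
              mul_le_mul (hcoord i j) (hcoord i k) (sq_nonneg _) (sq_nonneg _)
          _ = ‖xs i‖ * (‖xs i‖ ^ 2 * ‖xs i‖) := by ring
          _ ≤ M * (‖xs i‖ ^ 2 * ‖xs i‖) :=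
              mul_le_mul_of_nonneg_right (hM i hi') (by positivity)
          _ = _ := by field_simp
    · rw [← Finset.mul_sum]
      refine mul_le_mul_of_nonneg_left hT ?_
      have := (norm_nonneg _).trans (hM 0 hn)
      positivity
  refine (measure_mono hsub).trans ((measure_union_le _ _).trans (add_le_add ?_ ?_))
  · refine (measure_iUnion_fintype_le _ _).trans ((Finset.sum_le_sum fun j _ => hAle j).trans ?_)
    simp
  · refine (measure_iUnion_fintype_le _ _).trans ((Finset.sum_le_sum fun j _ =>
      (measure_iUnion_fintype_le _ _).trans (Finset.sum_le_sum fun k _ => hBle j k)).trans ?_)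
    simp

/-! ### Bounds on the design. -/

/-- A positive definite quadratic form is bounded below by a positive multiple of the squared
norm. -/
theorem Matrix.PosDef.exists_le_sum_mul {p : ℕ} {D : Matrix (Fin p) (Fin p) ℝ} (hD : D.PosDef) :
    ∃ lam > 0, ∀ v : EuclideanSpace ℝ (Fin p), lam * ‖v‖ ^ 2 ≤ ∑ j, ∑ k, v j * v k * D j k := by
  set q : EuclideanSpace ℝ (Fin p) → ℝ := fun v => ∑ j, ∑ k, v j * v k * D j k with hq
  have hpos : ∀ v, v ≠ 0 → 0 < q v := by
    intro v hv
    have h := hD.dotProduct_mulVec_pos (x := v.ofLp) (by simpa using hv)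
    simp only [dotProduct, Matrix.mulVec, Pi.star_apply, star_trivial, Finset.mul_sum] at h
    refine h.trans_le (le_of_eq ?_)
    exact Finset.sum_congr rfl fun j _ => Finset.sum_congr rfl fun k _ => by ring
  have hcont : Continuous q := by fun_prop
  have hsmul : ∀ (t : ℝ) v, q (t • v) = t ^ 2 * q v := by
    intro t v
    simp only [hq, PiLp.smul_apply, smul_eq_mul, Finset.mul_sum]
    exact Finset.sum_congr rfl fun j _ => Finset.sum_congr rfl fun k _ => by ring
  have hcase : ∃ lam > 0, ∀ w ∈ Metric.sphere (0 : EuclideanSpace ℝ (Fin p)) 1, lam ≤ q w := by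
    -- The unit sphere is empty when `p = 0`.
    rcases (Metric.sphere (0 : EuclideanSpace ℝ (Fin p)) 1).eq_empty_or_nonempty with he | hne
    · exact ⟨1, one_pos, by simp [he]⟩
    · obtain ⟨w, hw, hmin⟩ := (isCompact_sphere _ _).exists_isMinOn hne hcont.continuousOn
      exact ⟨q w, hpos w (by rintro rfl; simp at hw), fun z hz => hmin hz⟩
  obtain ⟨lam, hlam, hle⟩ := hcase
  refine ⟨lam, hlam, fun v => ?_⟩
  rcases eq_or_ne v 0 with rfl | hv
  · simp
  · have hn : 0 < ‖v‖ := norm_pos_iff.2 hv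
    have h := hle (‖v‖⁻¹ • v) (by simp [norm_smul, hn.ne'])
    rw [hsmul, inv_pow, inv_mul_eq_div, le_div_iff₀ (by positivity)] at h
    exact h

/-- Entrywise errors below `e` change the quadratic form by at most `p ^ 2 * e * ‖v‖ ^ 2`, which
costs half of the smallest eigenvalue bound; the trace of the limit gives `T`. -/
theorem RegularDesign.exists_bounds {p : ℕ} {xs : ℕ → EuclideanSpace ℝ (Fin p)}
    {μ : EuclideanSpace ℝ (Fin p) → Measure ℝ} {f : EuclideanSpace ℝ (Fin p) → ℝ → ℝ}
    (h : RegularDesign xs μ f) :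
    ∃ lam > 0, ∃ T > 0, ∀ᶠ n : ℕ in atTop,
      (∀ v : EuclideanSpace ℝ (Fin p),
        lam * n * ‖v‖ ^ 2 ≤ ∑ i ∈ Finset.range n, inner ℝ v (xs i) ^ 2) ∧
      ∑ i ∈ Finset.range n, ‖xs i‖ ^ 2 ≤ T * n := by
  -- Only the unweighted limit is wanted, so any interval of levels serves.
  obtain ⟨D, -, hD, -, hlim, -⟩ := h.moments (1 / 3) (2 / 3) (by norm_num) (by norm_num)
    (by norm_num)
  obtain ⟨lam, hlam, hle⟩ := hD.exists_le_sum_mul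
  set S : ℕ → Fin p → Fin p → ℝ := fun n j k =>
    (1 / (n : ℝ)) * ∑ i ∈ Finset.range n, xs i j * xs i k with hS
  have hentry : ∀ j k, Tendsto (fun n => S n j k) atTop (𝓝 (D j k)) := by
    intro j k
    have := tendsto_pi_nhds.1 (tendsto_pi_nhds.1 hlim j) k
    simpa [hS, Matrix.smul_apply, Matrix.sum_apply, Matrix.vecMulVec_apply] using this
  set e : ℝ := lam / (2 * (p ^ 2 + 1)) with he
  have he0 : 0 < e := by positivity
  have hpe : p ^ 2 * e ≤ lam / 2 := by
    rw [he, mul_div_assoc', div_le_div_iff₀ (by positivity) two_pos]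
    nlinarith
  refine ⟨lam / 2, half_pos hlam, (∑ j, (|D j j| + e)) + 1, ?_, ?_⟩
  · have : 0 ≤ ∑ j, (|D j j| + e) := Finset.sum_nonneg fun j _ => by positivity
    linarith
  have hev : ∀ᶠ n in atTop, ∀ j k, |S n j k - D j k| < e := by
    rw [eventually_all]; intro j
    rw [eventually_all]; intro k
    have := (Metric.tendsto_nhds.1 (hentry j k)) e he0
    simpa [Real.dist_eq] using this
  filter_upwards [hev, eventually_gt_atTop 0] with n hn hn0
  have hn' : (0 : ℝ) < n := by exact_mod_cast hn0
  have hSn : ∀ j k, ∑ i ∈ Finset.range n, xs i j * xs i k = n * S n j k := by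
    intro j k; simp only [hS]; field_simp
  constructor
  · intro v
    have hin : ∀ i, inner ℝ v (xs i) ^ 2 = ∑ j, ∑ k, v j * v k * (xs i j * xs i k) := by
      intro i
      have : inner ℝ v (xs i) = ∑ j, v j * xs i j := by
        rw [PiLp.inner_apply]; simp [mul_comm]
      rw [this, sq, Finset.sum_mul_sum]
      exact Finset.sum_congr rfl fun j _ => Finset.sum_congr rfl fun k _ => by ring
    have hsum : ∑ i ∈ Finset.range n, inner ℝ v (xs i) ^ 2 =
        n * ∑ j, ∑ k, v j * v k * S n j k := by
      simp only [hin, Finset.mul_sum]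
      rw [Finset.sum_comm]
      refine Finset.sum_congr rfl fun j _ => ?_
      rw [Finset.sum_comm]
      refine Finset.sum_congr rfl fun k _ => ?_
      rw [← Finset.mul_sum, hSn]; ring
    have hdiff : (∑ j, ∑ k, v j * v k * D j k) - p ^ 2 * e * ‖v‖ ^ 2 ≤
        ∑ j, ∑ k, v j * v k * S n j k := by
      have h1 : ∑ j, ∑ k, (v j * v k * D j k - ‖v‖ * ‖v‖ * e) ≤
          ∑ j, ∑ k, v j * v k * S n j k := by
        refine Finset.sum_le_sum fun j _ => Finset.sum_le_sum fun k _ => ?_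
        have h2 : |v j * v k * (S n j k - D j k)| ≤ ‖v‖ * ‖v‖ * e := by
          rw [abs_mul, abs_mul]
          exact mul_le_mul (mul_le_mul (PiLp.norm_apply_le v j) (PiLp.norm_apply_le v k)
            (abs_nonneg _) (norm_nonneg _)) (hn j k).le (abs_nonneg _) (by positivity)
        have h3 := (abs_le.1 h2).1
        linarith
      simp only [Finset.sum_sub_distrib, Finset.sum_const, Finset.card_univ, Fintype.card_fin,
        nsmul_eq_mul] at h1
      linarith
    rw [hsum]
    have h4 := mul_le_mul_of_nonneg_right hpe (sq_nonneg ‖v‖)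
    have h5 := hle v
    have h6 := mul_le_mul_of_nonneg_left
      (show lam / 2 * ‖v‖ ^ 2 ≤ ∑ j, ∑ k, v j * v k * S n j k by linarith) hn'.le
    linarith
  · have hsum : ∑ i ∈ Finset.range n, ‖xs i‖ ^ 2 = (∑ j, S n j j) * n := by
      have : ∀ i, ‖xs i‖ ^ 2 = ∑ j, xs i j * xs i j := by
        intro i; rw [EuclideanSpace.norm_sq_eq]; simp [sq]
      simp only [this]
      rw [Finset.sum_comm, Finset.sum_mul]
      exact Finset.sum_congr rfl fun j _ => by rw [hSn]; ring
    rw [hsum]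
    refine mul_le_mul_of_nonneg_right ?_ hn'.le
    have : ∑ j, S n j j ≤ ∑ j, (|D j j| + e) := by
      refine Finset.sum_le_sum fun j _ => ?_
      have h1 := (abs_lt.1 (hn j j)).2
      have h2 := le_abs_self (D j j)
      linarith
    linarith

/-! ### Consistency of quantile regression. -/

/-- Consistency of linear quantile regression at levels converging to a level in `(0, 1)`. -/
theorem tendsto_measure_quantileRegression {p : ℕ} {Ω : Type*} [MeasurableSpace Ω]
    {P : Measure Ω} [IsProbabilityMeasure P] {X : Set (EuclideanSpace ℝ (Fin p))}
    {μ : EuclideanSpace ℝ (Fin p) → Measure ℝ} {β : ℝ → EuclideanSpace ℝ (Fin p)}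
    {f : EuclideanSpace ℝ (Fin p) → ℝ → ℝ} {xs : ℕ → EuclideanSpace ℝ (Fin p)}
    (hxs : ∀ i, xs i ∈ X) {ys : ℕ → Ω → ℝ} (hys : ∀ i, Measurable (ys i))
    (hlaw : ∀ i, P.map (ys i) = μ (xs i)) (hindep : iIndepFun ys P)
    (h1 : LinearQuantileModel X μ β) (h2 : RegularDensities X μ f) (h3 : RegularDesign xs μ f)
    {τs : ℕ → ℝ} {τ : ℝ} (hτ : τ ∈ Ioo (0 : ℝ) 1) (hτs : Tendsto τs atTop (𝓝 τ))
    {b : ℕ → Ω → EuclideanSpace ℝ (Fin p)}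
    (hb : ∀ᶠ n in atTop, ∀ ω, IsQuantileRegression n xs (fun i => ys i ω) (τs n) (b n ω))
    {ε : ℝ} (hε : 0 < ε) :
    Tendsto (fun n => P {ω | ε ≤ ‖b n ω - β τ‖}) atTop (𝓝 0) := by
  obtain ⟨d, hd, hd1, hd2⟩ : ∃ d : ℝ, 0 < d ∧ 0 < τ - 2 * d ∧ τ + 2 * d < 1 := by
    refine ⟨min τ (1 - τ) / 4, ?_, ?_, ?_⟩
    · have := lt_min hτ.1 (sub_pos.2 hτ.2); linarith
    · have := min_le_left τ (1 - τ); linarith [hτ.1]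
    · have := min_le_right τ (1 - τ); linarith [hτ.2]
  obtain ⟨c, C, hc, hcC⟩ := h2.bounds (τ - 2 * d) (τ + 2 * d) hd1 (by linarith) hd2
  obtain ⟨lam, hlam, T, hT, hdesign⟩ := h3.exists_bounds
  -- This makes `2 * κ * T / c = lam / 2`. Next, `W` collects the coefficients of `η` in `hcond`,
  -- and `η` keeps `η * W` below `κ * lam / 4`, so a quarter of `κ * lam` is spare.
  set κ : ℝ := c * lam / (4 * T) with hκdef
  have hκ : 0 < κ := by positivity
  set W : ℝ := p + κ * p ^ 2 + 2 * κ ^ 2 * p / c with hW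
  have hW0 : 0 ≤ W := by positivity
  set η : ℝ := κ * lam / (4 * (W + 1)) with hηdef
  have hη : 0 < η := by positivity
  have hcond : p * η + κ * (2 * κ * T / c + η * p ^ 2 + 2 * κ * η * p / c) < κ * lam := by
    have e1 : 2 * κ * T / c = lam / 2 := by rw [hκdef]; field_simp; ring
    have e2 : p * η + κ * (lam / 2 + η * p ^ 2 + 2 * κ * η * p / c) = κ * lam / 2 + η * W := by
      rw [hW]; ring
    have e3 : η * W ≤ κ * lam / 4 := by
      have : η * (W + 1) = κ * lam / 4 := by rw [hηdef]; field_simp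
      linarith
    have : 0 < κ * lam := by positivity
    rw [e1, e2]
    linarith
  -- The first bound leaves `ε / 2` for the distance from `β (τs n)` to `β τ`; the second keeps the
  -- window levels within `d` of `τs n`.
  set s : ℝ := min (ε / 2) (d / κ) with hs
  have hs0 : 0 < s := lt_min (half_pos hε) (by positivity)
  set M : ℕ → ℝ := fun n => ⨆ i : Fin n, ‖xs i‖ with hMdef
  have hM0 : ∀ n, 0 ≤ M n := fun n => Real.iSup_nonneg fun i => norm_nonneg _
  have hMle : ∀ n i, i < n → ‖xs i‖ ≤ M n := fun n i hi =>
    le_ciSup (f := fun i : Fin n => ‖xs i‖) (Set.finite_range _).bddAbove ⟨i, hi⟩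
  -- The radius shrinks as the largest design point grows, so that all window levels stay in one
  -- compact interval; the Chebyshev bounds can afford it because `M n = o(√n)`.
  set r : ℕ → ℝ := fun n => s / (1 + M n) with hrdef
  have hr0 : ∀ n, 0 < r n := fun n => div_pos hs0 (by linarith [hM0 n])
  have hrs : ∀ n, r n ≤ s := fun n => div_le_self hs0.le (by linarith [hM0 n])
  have hrM : ∀ n i, i < n → κ * r n * ‖xs i‖ ≤ d := by
    intro n i hi
    have hpos : 0 < 1 + M n := by linarith [hM0 n]
    have h4 : r n * ‖xs i‖ ≤ s := by
      have : r n * (1 + M n) = s := div_mul_cancel₀ _ hpos.ne'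
      rw [← this]
      exact mul_le_mul_of_nonneg_left (by linarith [hMle n i hi]) (hr0 n).le
    have h5 : s ≤ d / κ := min_le_right _ _
    rw [mul_assoc, ← le_div_iff₀' hκ]
    exact h4.trans h5
  have hcontQ : ∀ x ∈ X, ContinuousOn (quantile (μ x)) (Ioo 0 1) := fun x hx =>
    (h1.cont.inner continuousOn_const).congr fun t ht => h1.linear x hx t ht
  have hbound : ∀ᶠ n in atTop, P {ω | ε ≤ ‖b n ω - β τ‖} ≤
      p * ENNReal.ofReal (T * n / (η * r n * n) ^ 2) +
        p * (p * ENNReal.ofReal (M n / (2 * κ * r n) * (T * n) / (η * n) ^ 2)) := by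
    have hβ : Tendsto (fun n => β (τs n)) atTop (𝓝 (β τ)) :=
      (h1.cont.continuousAt (isOpen_Ioo.mem_nhds hτ)).tendsto.comp hτs
    filter_upwards [hb, hdesign, eventually_gt_atTop 0, Metric.tendsto_nhds.1 hτs d hd,
      Metric.tendsto_nhds.1 hβ (ε / 2) (half_pos hε)] with n hbn hdn hn0 hτn hβn
    rw [Real.dist_eq, abs_lt] at hτn
    have hsub : {ω | ε ≤ ‖b n ω - β τ‖} ⊆ {ω | r n ≤ ‖b n ω - β (τs n)‖} := by
      intro ω (hω : ε ≤ _)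
      have h4 := norm_sub_le_norm_sub_add_norm_sub (b n ω) (β (τs n)) (β τ)
      rw [dist_eq_norm] at hβn
      have h5 : r n ≤ ε / 2 := (hrs n).trans (min_le_left _ _)
      show r n ≤ _
      linarith
    refine (measure_mono hsub).trans ?_
    have hδ : ∀ i, 0 ≤ κ * r n * ‖xs i‖ := fun i =>
      mul_nonneg (mul_nonneg hκ.le (hr0 n).le) (norm_nonneg _)
    have hτn01 : τs n ∈ Ioo (0 : ℝ) 1 := ⟨by linarith, by linarith⟩
    have hQ : ∀ i, inner ℝ (β (τs n)) (xs i) = quantile (μ (xs i)) (τs n) := fun i =>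
      (h1.linear _ (hxs i) _ hτn01).symm
    have hnull : ∀ i, NullSingletonClass (μ (xs i)) := fun i => by
      rw [h2.density _ (hxs i)]; infer_instance
    have hprob : ∀ i, IsProbabilityMeasure (μ (xs i)) := fun i => h1.prob _ (hxs i)
    have hslope : ∀ i s t, τ - 2 * d ≤ s → s ≤ t → t ≤ τ + 2 * d →
        quantile (μ (xs i)) t - quantile (μ (xs i)) s ≤ (t - s) / c := by
      intro i s t hs' hst ht
      rw [le_div_iff₀' hc]
      refine mul_quantile_sub_le (μ (xs i)) (h2.density _ (hxs i)) (by linarith) hst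
        (by linarith) ((hcontQ _ (hxs i)).mono fun u hu => ⟨by linarith [hu.1], by linarith [hu.2]⟩)
        fun u hu => (hcC u ⟨by linarith [hu.1], by linarith [hu.2]⟩ _ (hxs i)).1
    refine measure_le_norm_sub_le (lam := lam) hys hindep hbn hn0 (hr0 n) hκ hc hη
      (lo := fun i => quantile (μ (xs i)) (τs n - κ * r n * ‖xs i‖))
      (hi := fun i => quantile (μ (xs i)) (τs n + κ * r n * ‖xs i‖))
      hτn01.1.le hτn01.2.le ?_ ?_ ?_ ?_ ?_ ?_ hdn.1 hdn.2 (hMle n) hcond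
    · intro i hi
      have := hrM n i hi
      rw [hlaw, cdf_quantile _ (by linarith) (by linarith [hδ i])]
    · intro i hi
      have := hrM n i hi
      rw [hlaw, cdf_quantile _ (by linarith [hδ i]) (by linarith)]
    · intro i hi
      have := hrM n i hi
      rw [hQ]
      exact quantile_mono _ (by linarith) (by linarith [hδ i]) hτn01.2
    · intro i hi
      have := hrM n i hi
      rw [hQ]
      exact quantile_mono _ hτn01.1 (by linarith [hδ i]) (by linarith)
    · intro i hi
      have := hrM n i hi
      have h4 := hslope i (τs n - κ * r n * ‖xs i‖) (τs n) (by linarith) (by linarith [hδ i])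
        (by linarith)
      rw [sub_sub_cancel] at h4
      rw [hQ]
      linarith
    · intro i hi
      have := hrM n i hi
      have h4 := hslope i (τs n) (τs n + κ * r n * ‖xs i‖) (by linarith) (by linarith [hδ i])
        (by linarith)
      rw [add_sub_cancel_left] at h4
      rw [hQ]
      linarith
  -- Up to constants, both Chebyshev bounds are at most `(1 + M n) ^ 2 / n`.
  have hratio : Tendsto (fun n : ℕ => ((1 + M n) / √n) ^ 2) atTop (𝓝 0) := by
    have hsqrt : Tendsto (fun n : ℕ => √(n : ℝ)) atTop atTop :=
      Real.tendsto_sqrt_atTop.comp tendsto_natCast_atTop_atTop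
    have ho : (fun n : ℕ => 1 + M n) =o[atTop] fun n : ℕ => √(n : ℝ) := by
      refine Asymptotics.IsLittleO.add ?_ h3.maxNorm
      exact (Asymptotics.isLittleO_const_left.2 (Or.inr (tendsto_norm_atTop_atTop.comp hsqrt)))
    simpa using ho.tendsto_div_nhds_zero.pow 2
  have l1 : Tendsto (fun n : ℕ => T * n / (η * r n * n) ^ 2) atTop (𝓝 0) := by
    have h4 := hratio.const_mul (T / (η ^ 2 * s ^ 2))
    rw [mul_zero] at h4
    refine h4.congr' ?_
    filter_upwards [eventually_gt_atTop 0] with n hn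
    have hn' : (0 : ℝ) < n := by exact_mod_cast hn
    have hpos : 0 < 1 + M n := by linarith [hM0 n]
    rw [div_pow (1 + M n), Real.sq_sqrt hn'.le]
    simp only [hrdef]
    field_simp
  have l2 : Tendsto (fun n : ℕ => M n / (2 * κ * r n) * (T * n) / (η * n) ^ 2) atTop (𝓝 0) := by
    have h4 := hratio.const_mul (T / (2 * κ * s * η ^ 2))
    rw [mul_zero] at h4
    refine squeeze_zero' (Eventually.of_forall fun n => ?_) ?_ h4
    · have := hM0 n
      have := hr0 n
      positivity
    · filter_upwards [eventually_gt_atTop 0] with n hn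
      have hn' : (0 : ℝ) < n := by exact_mod_cast hn
      have hpos : 0 < 1 + M n := by linarith [hM0 n]
      have e : M n / (2 * κ * r n) * (T * n) / (η * n) ^ 2 =
          T / (2 * κ * s * η ^ 2) * (M n * (1 + M n) / n) := by
        simp only [hrdef]
        field_simp
      rw [e, div_pow (1 + M n), Real.sq_sqrt hn'.le]
      gcongr
      rw [sq]
      exact mul_le_mul_of_nonneg_right (by linarith) hpos.le
  refine tendsto_of_tendsto_of_tendsto_of_le_of_le' tendsto_const_nhds ?_
    (Eventually.of_forall fun n => zero_le) hbound
  have m1 := ENNReal.tendsto_ofReal l1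
  have m2 := ENNReal.tendsto_ofReal l2
  rw [ENNReal.ofReal_zero] at m1 m2
  have hp : (p : ℝ≥0∞) ≠ ∞ := ENNReal.natCast_ne_top p
  have := (ENNReal.Tendsto.const_mul m1 (Or.inr hp)).add
    (ENNReal.Tendsto.const_mul (ENNReal.Tendsto.const_mul m2 (Or.inr hp)) (Or.inr hp))
  simpa using this

/-! ### From closeness in probability to closeness of the risk. -/

/-- Comparison of the expectations of a bounded function, Lipschitz on `[0, A)` and zero on
`[A, ∞)`, of two variables that are close in probability, the second one being nonnegative. -/
theorem abs_integral_map_sub_le {Λ : Type*} [MeasurableSpace Λ] {ρ : Measure Λ}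
    [IsProbabilityMeasure ρ] {Z Y : Λ → ℝ} (hZ : Measurable Z) (hY : Measurable Y)
    {H : ℝ → ℝ} (hH : Measurable H) {A B K ε δ θ : ℝ} (hB : ∀ y, |H y| ≤ B)
    (hlip : ∀ y ∈ Ico 0 A, ∀ z ∈ Ico 0 A, |H y - H z| ≤ K * |y - z|) (hK : 0 ≤ K)
    (hzero : ∀ y, A ≤ y → H y = 0) (hnonneg : ρ.map Y (Iio 0) = 0) (hε : 0 ≤ ε)
    (hδ : ∀ t, (ρ.map Y).real (Icc (t - ε) (t + ε)) ≤ δ)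
    (hθ : ρ.real {z | ε ≤ |Z z - Y z|} ≤ θ) :
    |∫ y, H y ∂(ρ.map Z) - ∫ y, H y ∂(ρ.map Y)| ≤ K * ε + 4 * B * δ + 2 * B * θ := by
  have hB0 : 0 ≤ B := (abs_nonneg _).trans (hB 0)
  have hint : ∀ {V : Λ → ℝ}, Measurable V → Integrable (fun z => H (V z)) ρ := fun hV =>
    Integrable.of_bound (hH.comp hV).aestronglyMeasurable B (Eventually.of_forall fun z => hB _)
  rw [integral_map hZ.aemeasurable hH.aestronglyMeasurable,
    integral_map hY.aemeasurable hH.aestronglyMeasurable, ← integral_sub (hint hZ) (hint hY)]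
  -- Off these three sets `Y` and `Z` lie on the same side of both jump points `0` and `A`; on them
  -- the trivial bound `2 * B` is used.
  set S₁ : Set Λ := Y ⁻¹' Icc (0 - ε) (0 + ε) with hS₁
  set S₂ : Set Λ := Y ⁻¹' Icc (A - ε) (A + ε) with hS₂
  set S₃ : Set Λ := {z | ε ≤ |Z z - Y z|} with hS₃
  have m₁ : MeasurableSet S₁ := hY measurableSet_Icc
  have m₂ : MeasurableSet S₂ := hY measurableSet_Icc
  have m₃ : MeasurableSet S₃ := measurableSet_le measurable_const (hZ.sub hY).abs
  have hpt : ∀ᵐ z ∂ρ, ‖H (Z z) - H (Y z)‖ ≤ K * ε + S₁.indicator (fun _ => 2 * B) z +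
      S₂.indicator (fun _ => 2 * B) z + S₃.indicator (fun _ => 2 * B) z := by
    have hae : ∀ᵐ z ∂ρ, 0 ≤ Y z := by
      rw [Measure.map_apply hY measurableSet_Iio] at hnonneg
      filter_upwards [measure_eq_zero_iff_ae_notMem.1 hnonneg] with z hz
      simpa using hz
    filter_upwards [hae] with z hz
    have hind : ∀ S : Set Λ, 0 ≤ S.indicator (fun _ => 2 * B) z := fun S =>
      indicator_nonneg (fun _ _ => by positivity) z
    have hKε : 0 ≤ K * ε := mul_nonneg hK hε
    have htriv : ‖H (Z z) - H (Y z)‖ ≤ 2 * B := by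
      have h1 := abs_sub (H (Z z)) (H (Y z))
      have h2 := hB (Z z)
      have h3 := hB (Y z)
      rw [Real.norm_eq_abs]
      linarith
    have i1 := hind S₁
    have i2 := hind S₂
    have i3 := hind S₃
    by_cases c3 : z ∈ S₃
    · rw [indicator_of_mem c3]; linarith
    by_cases c2 : z ∈ S₂
    · rw [indicator_of_mem c2]; linarith
    by_cases c1 : z ∈ S₁
    · rw [indicator_of_mem c1]; linarith
    suffices h : ‖H (Z z) - H (Y z)‖ ≤ K * ε by linarith
    have c3' : |Z z - Y z| < ε := not_le.1 c3
    obtain ⟨d1, d2⟩ := abs_lt.1 c3'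
    -- Hence `Z z > 0` as well, and the uncontrolled variation of `H` below `0` plays no role.
    have c1' : ε < Y z := by
      by_contra! hle
      exact c1 ⟨by linarith, by linarith⟩
    rcases lt_or_ge (Y z) A with hYA | hYA
    · have c2' : Y z < A - ε := by
        by_contra! hle
        exact c2 ⟨hle, by linarith⟩
      exact (hlip _ ⟨by linarith, by linarith⟩ _ ⟨hz, hYA⟩).trans
        (mul_le_mul_of_nonneg_left c3'.le hK)
    · have c2' : A + ε < Y z := by
        by_contra! hle
        exact c2 ⟨by linarith, hle⟩
      rw [hzero _ hYA, hzero _ (by linarith)]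
      simpa using hKε
  have j₁ : Integrable (S₁.indicator fun _ => 2 * B) ρ := (integrable_const _).indicator m₁
  have j₂ : Integrable (S₂.indicator fun _ => 2 * B) ρ := (integrable_const _).indicator m₂
  have j₃ : Integrable (S₃.indicator fun _ => 2 * B) ρ := (integrable_const _).indicator m₃
  have r₁ : ρ.real S₁ ≤ δ := by
    rw [← map_measureReal_apply hY measurableSet_Icc]; exact hδ 0
  have r₂ : ρ.real S₂ ≤ δ := by
    rw [← map_measureReal_apply hY measurableSet_Icc]; exact hδ A
  have hI := norm_integral_le_of_norm_le
    ((((integrable_const (K * ε)).add j₁).add j₂).add j₃) hpt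
  have j₁' : Integrable (fun z => K * ε + S₁.indicator (fun _ => 2 * B) z) ρ :=
    (integrable_const (K * ε)).add j₁
  have j₂' : Integrable (fun z => K * ε + S₁.indicator (fun _ => 2 * B) z +
      S₂.indicator (fun _ => 2 * B) z) ρ := j₁'.add j₂
  have hI := norm_integral_le_of_norm_le (j₂'.add j₃) hpt
  have hval : ∫ z, (K * ε + S₁.indicator (fun _ => 2 * B) z +
      S₂.indicator (fun _ => 2 * B) z + S₃.indicator (fun _ => 2 * B) z) ∂ρ =
      K * ε + ρ.real S₁ * (2 * B) + ρ.real S₂ * (2 * B) + ρ.real S₃ * (2 * B) := by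
    rw [integral_add j₂' j₃, integral_add j₁' j₂, integral_add (integrable_const _) j₁,
      integral_indicator_const _ m₁, integral_indicator_const _ m₂, integral_indicator_const _ m₃]
    simp
  rw [Real.norm_eq_abs] at hI
  refine hI.trans (hval.le.trans ?_)
  have k₁ := mul_le_mul_of_nonneg_right r₁ (show 0 ≤ 2 * B by linarith)
  have k₂ := mul_le_mul_of_nonneg_right r₂ (show 0 ≤ 2 * B by linarith)
  have k₃ := mul_le_mul_of_nonneg_right hθ (show 0 ≤ 2 * B by linarith)
  linarith

/-- The index of the fitted quantile is itself a measurable function of the input; countability of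
the index set makes `q` jointly measurable. -/
theorem measurable_qrgmm_comp {Λ : Type*} [MeasurableSpace Λ] (m : ℕ) {q : ℕ → Λ → ℝ}
    (hq : ∀ j, Measurable (q j)) {u : Λ → ℝ} (hu : Measurable u) :
    Measurable fun z => qrgmm m (fun j => q j z) (u z) := by
  have hk : Measurable fun z => ⌊(m : ℝ) * u z⌋₊ := Nat.measurable_floor.comp (hu.const_mul _)
  have hpair : Measurable fun w : ℕ × Λ => q w.1 w.2 := measurable_from_prod_countable_right hq
  have h1 : Measurable fun z => q ⌊(m : ℝ) * u z⌋₊ z := hpair.comp (hk.prodMk measurable_id)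
  have h2 : Measurable fun z => q (⌊(m : ℝ) * u z⌋₊ + 1) z :=
    hpair.comp ((hk.add_const 1).prodMk measurable_id)
  have h3 : Measurable fun z => (⌊(m : ℝ) * u z⌋₊ : ℝ) := measurable_from_top.comp hk
  unfold qrgmm
  refine Measurable.ite (measurableSet_lt hu measurable_const) (hq 1)
    (Measurable.ite (measurableSet_le measurable_const hu) (hq _) ?_)
  exact h1.add ((measurable_const.mul (hu.sub (h3.div_const _))).mul (h2.sub h1))

/-- Since `δ` bounds the intervals around every centre, the error does not depend on where `a l`
lies, and the supremum over `l` costs nothing. -/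
theorem supDist_riskThree_map_le {Λ : Type*} [MeasurableSpace Λ] {ρ : Measure Λ}
    [IsProbabilityMeasure ρ] {Z Y : Λ → ℝ} (hZ : Measurable Z) (hY : Measurable Y)
    {lbar B K ε δ θ : ℝ} {a : ℝ → ℝ} {g : ℝ → ℝ → ℝ} (hK : 0 ≤ K)
    (hmeas : ∀ l ∈ Icc 0 lbar, Measurable ((Iio (a l)).indicator (g l)))
    (hB : ∀ l ∈ Icc 0 lbar, ∀ y, |(Iio (a l)).indicator (g l) y| ≤ B)
    (hlip : ∀ l ∈ Icc 0 lbar, ∀ y ∈ Ico 0 (a l), ∀ z ∈ Ico 0 (a l),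
      |g l y - g l z| ≤ K * |y - z|)
    (hnonneg : ρ.map Y (Iio 0) = 0) (hε : 0 ≤ ε)
    (hδ : ∀ t, (ρ.map Y).real (Icc (t - ε) (t + ε)) ≤ δ)
    (hθ : ρ.real {z | ε ≤ |Z z - Y z|} ≤ θ) :
    supDist lbar (riskThree g a (ρ.map Z)) (riskThree g a (ρ.map Y)) ≤
      ENNReal.ofReal (K * ε + 4 * B * δ + 2 * B * θ) := by
  refine iSup₂_le fun l hl => ENNReal.ofReal_le_ofReal ?_
  refine abs_integral_map_sub_le (A := a l) hZ hY (hmeas l hl) (hB l hl) ?_ hK ?_ hnonneg hε hδ hθ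
  · intro y hy z hz
    rw [indicator_of_mem (by exact hy.2), indicator_of_mem (by exact hz.2)]
    exact hlip l hl y hy z hz
  · intro y hy
    exact indicator_of_notMem (by simpa using hy) _

/-- Convergence of the generated values in probability implies convergence of the risk measure. -/
theorem riskConverges_of_tendsto {p : ℕ} {Ω : Type*} [MeasurableSpace Ω] {P : Measure Ω}
    [IsProbabilityMeasure P] {m : ℕ → ℕ} {b : ℕ → ℕ → Ω → EuclideanSpace ℝ (Fin p)}
    (hbmeas : ∀ n j, Measurable (b n j)) {x : EuclideanSpace ℝ (Fin p)} {ν : Measure ℝ}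
    [IsProbabilityMeasure ν] (hν : ν ≪ volume) (hν0 : ν (Iio 0) = 0) {Y : ℝ → ℝ}
    (hY : Measurable Y) (hYlaw : unifLaw.map Y = ν)
    (hconv : ∀ ε > 0, Tendsto (fun n => (P.prod unifLaw)
      {z | ε ≤ |qrgmm (m n) (fun j => inner ℝ (b n j z.1) x) z.2 - Y z.2|}) atTop (𝓝 0))
    {lbar B K : ℝ} {a : ℝ → ℝ} {g : ℝ → ℝ → ℝ} (hB0 : 0 ≤ B) (hK : 0 ≤ K)
    (hmeas : ∀ l ∈ Icc 0 lbar, Measurable ((Iio (a l)).indicator (g l)))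
    (hB : ∀ l ∈ Icc 0 lbar, ∀ y, |(Iio (a l)).indicator (g l) y| ≤ B)
    (hlip : ∀ l ∈ Icc 0 lbar, ∀ y ∈ Ico 0 (a l), ∀ z ∈ Ico 0 (a l),
      |g l y - g l z| ≤ K * |y - z|) :
    RiskConverges P m b x ν lbar g a := by
  have hin : Measurable fun v : EuclideanSpace ℝ (Fin p) => (inner ℝ v x : ℝ) :=
    (continuous_id.inner continuous_const).measurable
  have hq : ∀ n j, Measurable fun z : Ω × ℝ => (inner ℝ (b n j z.1) x : ℝ) := fun n j =>
    hin.comp ((hbmeas n j).comp measurable_fst)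
  have hZ : ∀ n, Measurable fun z : Ω × ℝ =>
      qrgmm (m n) (fun j => inner ℝ (b n j z.1) x) z.2 := fun n =>
    measurable_qrgmm_comp (m n) (hq n) measurable_snd
  have hset : ∀ n ε, MeasurableSet
      {z : Ω × ℝ | ε ≤ |qrgmm (m n) (fun j => inner ℝ (b n j z.1) x) z.2 - Y z.2|} := fun n ε =>
    measurableSet_le measurable_const ((hZ n).sub (hY.comp measurable_snd)).abs
  -- The error `e` is shared as `e / 4` for the Lipschitz part, `e / 4` for the two jumps and `e /
  -- 2` for the event that the variables are far apart. Adding `1` to `B` and `K` avoids division by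
  -- zero.
  have key : ∀ e : ℝ, 0 < e → ∃ ε > 0, ∃ δ, (∀ t, ν.real (Icc (t - ε) (t + ε)) ≤ δ) ∧
      K * ε + 4 * B * δ + 2 * B * (e / (4 * (B + 1))) ≤ e := by
    intro e he
    obtain ⟨ε₀, hε₀, hle⟩ := exists_measure_Icc_le ν hν
      (δ := ENNReal.ofReal (e / (16 * (B + 1)))) (by simp; positivity)
    refine ⟨min ε₀ (e / (4 * (K + 1))), lt_min hε₀ (by positivity), e / (16 * (B + 1)),
      fun t => ENNReal.toReal_le_of_le_ofReal (by positivity) (hle _ (min_le_left _ _) t), ?_⟩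
    have b1 : K * min ε₀ (e / (4 * (K + 1))) ≤ e / 4 := by
      refine (mul_le_mul_of_nonneg_left (min_le_right _ _) hK).trans ?_
      rw [mul_div_assoc', div_le_div_iff₀ (by positivity) (by positivity)]
      nlinarith
    have b2 : 4 * B * (e / (16 * (B + 1))) ≤ e / 4 := by
      rw [mul_div_assoc', div_le_div_iff₀ (by positivity) (by positivity)]
      nlinarith
    have b3 : 2 * B * (e / (4 * (B + 1))) ≤ e / 2 := by
      rw [mul_div_assoc', div_le_div_iff₀ (by positivity) (by positivity)]
      nlinarith
    linarith
  constructor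
  · intro ε₁ hε₁
    obtain ⟨e, he, heε⟩ : ∃ e : ℝ, 0 < e ∧ ENNReal.ofReal e < ε₁ := by
      obtain ⟨e, he0, he⟩ := ENNReal.lt_iff_exists_nnreal_btwn.1 hε₁
      exact ⟨e, by exact_mod_cast he0, by simpa using he⟩
    obtain ⟨ε, hε, δ, hδ, hsum⟩ := key e he
    set θ : ℝ := e / (4 * (B + 1)) with hθdef
    have hθ : 0 < θ := by positivity
    have hθ0 : ENNReal.ofReal θ ≠ 0 := by simpa using hθ
    have hdiv := ENNReal.Tendsto.div_const (hconv ε hε) (b := ENNReal.ofReal θ) (Or.inr hθ0)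
    rw [ENNReal.zero_div] at hdiv
    refine tendsto_of_tendsto_of_tendsto_of_le_of_le tendsto_const_nhds hdiv
      (fun n => zero_le) fun n => ?_
    -- A large error forces the probability of a bad input given the data to be at least `θ`;
    -- Markov's inequality and Fubini bound this by the joint probability over `θ`. Only
    -- monotonicity of `P` is used, so `supDist` need not be measurable in `ω`.
    have hsub : {ω | ε₁ ≤ supDist lbar (riskThree g a (genLaw (m n) (fun j => b n j ω) x))
        (riskThree g a ν)} ⊆ {ω | ENNReal.ofReal θ ≤ unifLaw (Prod.mk ω ⁻¹'
          {z | ε ≤ |qrgmm (m n) (fun j => inner ℝ (b n j z.1) x) z.2 - Y z.2|})} := by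
      intro ω (hω : ε₁ ≤ _)
      by_contra hlt
      rw [mem_ofPred_eq] at hlt
      have hlt' := (not_le.1 hlt).le
      refine absurd hω (not_le.2 (lt_of_le_of_lt ?_ heε))
      rw [genLaw, ← hYlaw]
      refine (supDist_riskThree_map_le (ε := ε) (δ := δ) (θ := θ)
        ((hZ n).comp measurable_prodMk_left) hY hK hmeas hB hlip (by rw [hYlaw]; exact hν0)
        hε.le (by rw [hYlaw]; exact hδ) ?_).trans (ENNReal.ofReal_le_ofReal hsum)
      exact ENNReal.toReal_le_of_le_ofReal hθ.le hlt'
    refine (measure_mono hsub).trans ?_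
    refine (meas_ge_le_lintegral_div
      (measurable_measure_prodMk_left (hset n ε)).aemeasurable hθ0 ENNReal.ofReal_ne_top).trans ?_
    rw [Measure.prod_apply (hset n ε)]
  · rw [ENNReal.tendsto_nhds_zero]
    intro ε₁ hε₁
    obtain ⟨e, he, heε⟩ : ∃ e : ℝ, 0 < e ∧ ENNReal.ofReal e < ε₁ := by
      obtain ⟨e, he0, he⟩ := ENNReal.lt_iff_exists_nnreal_btwn.1 hε₁
      exact ⟨e, by exact_mod_cast he0, by simpa using he⟩
    obtain ⟨ε, hε, δ, hδ, hsum⟩ := key e he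
    have hθ : 0 < e / (4 * (B + 1)) := by positivity
    filter_upwards [ENNReal.tendsto_nhds_zero.1 (hconv ε hε)
      (ENNReal.ofReal (e / (4 * (B + 1)))) (by simpa using hθ)] with n hn
    have hlaw : (P.prod unifLaw).map (fun z => Y z.2) = ν := by
      have h := Measure.map_map (μ := P.prod unifLaw) hY measurable_snd
      rw [Measure.map_snd_prod, measure_univ, one_smul, hYlaw] at h
      exact h.symm
    refine le_trans ?_ heε.le
    rw [genLawJoint, ← hlaw]
    refine (supDist_riskThree_map_le (ε := ε) (δ := δ) (hZ n) (hY.comp measurable_snd) hK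
      hmeas hB hlip (by rw [← hν0, ← hlaw]; rfl) hε.le (fun t => ?_)
      (ENNReal.toReal_le_of_le_ofReal hθ.le hn)).trans (ENNReal.ofReal_le_ofReal hsum)
    have := hδ t
    rw [← hlaw] at this
    exact this

/-! ### Generated values and the conclusion. -/

theorem ContinuousOn.measurable_indicator {h : ℝ → ℝ} {s : Set ℝ} (hh : ContinuousOn h s)
    (hs : MeasurableSet s) : Measurable (s.indicator h) := by
  classical
  rw [← piecewise_eq_indicator]
  exact hh.measurable_piecewise continuousOn_const hs

/-- At an interior input the QRGMM generator interpolates between two adjacent fitted quantiles. -/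
theorem abs_qrgmm_sub_le {m : ℕ} {q : ℕ → ℝ} {u y A : ℝ} (hm : 0 < m) (h1 : 1 / (m : ℝ) ≤ u)
    (h2 : u < ((m : ℝ) - 1) / m) (hq : |q ⌊(m : ℝ) * u⌋₊ - y| ≤ A)
    (hq' : |q (⌊(m : ℝ) * u⌋₊ + 1) - y| ≤ A) : |qrgmm m q u - y| ≤ A := by
  have hm' : (0 : ℝ) < m := by exact_mod_cast hm
  have hu : 0 ≤ (m : ℝ) * u := mul_nonneg hm'.le (le_trans (by positivity) h1)
  rw [qrgmm, if_neg (not_lt.2 h1), if_neg (not_le.2 h2)]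
  set k := ⌊(m : ℝ) * u⌋₊
  have ht : (m : ℝ) * (u - (k : ℝ) / m) = m * u - k := by field_simp
  have ht0 : 0 ≤ (m : ℝ) * u - k := sub_nonneg.2 (Nat.floor_le hu)
  have ht1 : (m : ℝ) * u - k ≤ 1 := by linarith [Nat.lt_floor_add_one ((m : ℝ) * u)]
  rw [ht]
  set t := (m : ℝ) * u - k
  have e : q k + t * (q (k + 1) - q k) - y = (1 - t) * (q k - y) + t * (q (k + 1) - y) := by ring
  rw [e]
  refine (abs_add_le _ _).trans ?_
  rw [abs_mul, abs_mul, abs_of_nonneg ht0, abs_of_nonneg (sub_nonneg.2 ht1)]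
  have b1 := mul_le_mul_of_nonneg_left hq (sub_nonneg.2 ht1)
  have b2 := mul_le_mul_of_nonneg_left hq' ht0
  linarith

/-- The values generated by QRGMM converge in probability, for almost every uniform input, to the
conditional quantile. -/
theorem tendsto_measure_qrgmm {p : ℕ} {Ω : Type*} [MeasurableSpace Ω]
    {P : Measure Ω} [IsProbabilityMeasure P] {X : Set (EuclideanSpace ℝ (Fin p))}
    {μ : EuclideanSpace ℝ (Fin p) → Measure ℝ} {β : ℝ → EuclideanSpace ℝ (Fin p)}
    {f : EuclideanSpace ℝ (Fin p) → ℝ → ℝ} {xs : ℕ → EuclideanSpace ℝ (Fin p)}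
    (hxs : ∀ i, xs i ∈ X) {ys : ℕ → Ω → ℝ} (hys : ∀ i, Measurable (ys i))
    (hlaw : ∀ i, P.map (ys i) = μ (xs i)) (hindep : iIndepFun ys P)
    (h1 : LinearQuantileModel X μ β) (h2 : RegularDensities X μ f) (h3 : RegularDesign xs μ f)
    {m : ℕ → ℕ} (hm : Tendsto m atTop atTop) {b : ℕ → ℕ → Ω → EuclideanSpace ℝ (Fin p)}
    (hb : ∀ n j, 1 ≤ j → j < m n → ∀ ω,
      IsQuantileRegression n xs (fun i => ys i ω) ((j : ℝ) / m n) (b n j ω))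
    (x : EuclideanSpace ℝ (Fin p)) {u : ℝ} (hu : u ∈ Ioo (0 : ℝ) 1) {ε : ℝ} (hε : 0 < ε) :
    Tendsto (fun n => P {ω | ε ≤ |qrgmm (m n) (fun j => inner ℝ (b n j ω) x) u -
      inner ℝ (β u) x|}) atTop (𝓝 0) := by
  have hmR : Tendsto (fun n => (m n : ℝ)) atTop atTop := tendsto_natCast_atTop_atTop.comp hm
  have hinv : Tendsto (fun n => 1 / (m n : ℝ)) atTop (𝓝 0) :=
    tendsto_const_nhds.div_atTop hmR
  -- The two levels around `u` move with `n`, which is why consistency is needed along convergent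
  -- levels.
  set k : ℕ → ℕ := fun n => ⌊(m n : ℝ) * u⌋₊ with hk
  have hk1 : Tendsto (fun n => ((k n : ℕ) : ℝ) / m n) atTop (𝓝 u) := by
    have := (tendsto_nat_floor_mul_div_atTop hu.1.le).comp hmR
    refine this.congr fun n => ?_
    simp [hk, mul_comm]
  have hk2 : Tendsto (fun n => ((k n + 1 : ℕ) : ℝ) / m n) atTop (𝓝 u) := by
    have := hk1.add hinv
    rw [add_zero] at this
    refine this.congr fun n => ?_
    push_cast
    ring
  have hm0 : ∀ᶠ n in atTop, 0 < m n := hm.eventually_gt_atTop 0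
  have hlo : ∀ᶠ n in atTop, 1 / (m n : ℝ) < u := hinv.eventually (gt_mem_nhds hu.1)
  have hhi : ∀ᶠ n in atTop, 1 / (m n : ℝ) < 1 - u :=
    hinv.eventually (gt_mem_nhds (sub_pos.2 hu.2))
  -- Only the indices `1 ≤ j < m n` carry regression estimates; both neighbours are eventually among
  -- them, since `u` is interior.
  have hkpos : ∀ᶠ n in atTop, 1 ≤ k n := by
    filter_upwards [hm0, hlo] with n hn hn'
    have : (0 : ℝ) < m n := by exact_mod_cast hn
    rw [div_lt_iff₀' this] at hn'
    exact (Nat.one_le_floor_iff _).2 hn'.le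
  have hklt : ∀ᶠ n in atTop, k n + 1 < m n := by
    filter_upwards [hm0, hk2.eventually (gt_mem_nhds hu.2)] with n hn hn'
    have : (0 : ℝ) < m n := by exact_mod_cast hn
    rw [div_lt_one this] at hn'
    exact_mod_cast hn'
  have hε' : 0 < ε / (‖x‖ + 1) := by positivity
  have c1 := tendsto_measure_quantileRegression hxs hys hlaw hindep h1 h2 h3 hu hk1
    (b := fun n => b n (k n)) (by
      filter_upwards [hkpos, hklt] with n hn hn'
      exact hb n _ hn (by lia)) hε'
  have c2 := tendsto_measure_quantileRegression hxs hys hlaw hindep h1 h2 h3 hu hk2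
    (b := fun n => b n (k n + 1)) (by
      filter_upwards [hklt] with n hn'
      exact hb n _ (by lia) hn') hε'
  have c3 := c1.add c2
  rw [add_zero] at c3
  refine tendsto_of_tendsto_of_tendsto_of_le_of_le' tendsto_const_nhds c3
    (Eventually.of_forall fun n => zero_le) ?_
  filter_upwards [hm0, hlo, hhi] with n hn0 hnlo hnhi
  refine (measure_mono fun ω hω => ?_).trans (measure_union_le _ _)
  by_contra hnot
  simp only [mem_union, mem_ofPred_eq, not_or, not_le] at hnot
  refine absurd hω (not_le.2 (?_ : _ < ε))
  have hclose : ∀ w : EuclideanSpace ℝ (Fin p), ‖w - β u‖ < ε / (‖x‖ + 1) →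
      |inner ℝ w x - inner ℝ (β u) x| ≤ ε / (‖x‖ + 1) * ‖x‖ := by
    intro w hw
    rw [← inner_sub_left]
    exact (abs_real_inner_le_norm _ _).trans
      (mul_le_mul_of_nonneg_right hw.le (norm_nonneg _))
  have hmpos : (0 : ℝ) < m n := by exact_mod_cast hn0
  refine (abs_qrgmm_sub_le (q := fun j => inner ℝ (b n j ω) x) hn0 hnlo.le ?_
    (hclose _ hnot.1) (hclose _ hnot.2)).trans_lt ?_
  · rw [sub_div, div_self hmpos.ne']; linarith
  · rw [div_mul_eq_mul_div, div_lt_iff₀ (by positivity)]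
    nlinarith

theorem theorem3 {p : ℕ} {Ω : Type*} [MeasurableSpace Ω] (P : Measure Ω) [IsProbabilityMeasure P]
    (X : Set (EuclideanSpace ℝ (Fin p)))
    (μ : EuclideanSpace ℝ (Fin p) → Measure ℝ)
    (β : ℝ → EuclideanSpace ℝ (Fin p))
    (f : EuclideanSpace ℝ (Fin p) → ℝ → ℝ)
    -- the data: design points in `X` and independent responses `y_i` with law `μ (x_i)`
    (xs : ℕ → EuclideanSpace ℝ (Fin p)) (hxs : ∀ i, xs i ∈ X)
    (ys : ℕ → Ω → ℝ) (hys : ∀ i, Measurable (ys i))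
    (hlaw : ∀ i, P.map (ys i) = μ (xs i)) (hindep : iIndepFun ys P)
    -- the model, density and design conditions
    (h1 : LinearQuantileModel X μ β)
    (h2 : RegularDensities X μ f)
    (h3 : RegularDesign xs μ f)
    -- the risk measure
    (lbar : ℝ) (hlbar : 0 < lbar) (a : ℝ → ℝ) (g : ℝ → ℝ → ℝ) (K : ℝ≥0)
    (h4 : RegularRisk lbar a g K)
    -- the number of grid points, as a function of the sample size
    (m : ℕ → ℕ) (hm : Tendsto m atTop atTop)
    (hnm : Tendsto (fun n : ℕ => (n : ℝ) / m n) atTop atTop)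
    -- `b n j` is the fitted coefficient at level `j / m n` from the first `n` data points
    (b : ℕ → ℕ → Ω → EuclideanSpace ℝ (Fin p))
    (hbmeas : ∀ n j, Measurable (b n j))
    (hb : ∀ n j, 1 ≤ j → j < m n → ∀ ω,
      IsQuantileRegression n xs (fun i => ys i ω) ((j : ℝ) / m n) (b n j ω))
    (x : EuclideanSpace ℝ (Fin p)) (hx : x ∈ X) :
    -- generated values below `0` discarded
    RiskConverges P m b x (μ x) lbar (fun l => (Ici 0).indicator (g l)) a ∧
    -- generated values below `0` retained, `g_l` having the same bound there
    ((∀ l ∈ Icc 0 lbar, Measurable (g l)) →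
      (∀ l ∈ Icc 0 lbar, ∀ y < 0, |g l y| ≤ g lbar 0) →
      RiskConverges P m b x (μ x) lbar g a) := by
  have hprob := h1.prob x hx
  have hac : μ x ≪ volume := by
    rw [h2.density x hx]; exact withDensity_absolutelyContinuous _ _
  -- The quantile coupling, driven by the same uniform input as the generator; the value `0` off
  -- `(0,1)` only secures measurability.
  set Y : ℝ → ℝ := (Ioo (0 : ℝ) 1).indicator fun u => inner ℝ (β u) x with hYdef
  have hY : Measurable Y :=
    (h1.cont.inner continuousOn_const).measurable_indicator measurableSet_Ioo
  have hYlaw : unifLaw.map Y = μ x := map_unifLaw_eq (μ x) hY fun u hu => by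
    rw [hYdef, indicator_of_mem hu, h1.linear x hx u hu]
  have hin : Measurable fun v : EuclideanSpace ℝ (Fin p) => (inner ℝ v x : ℝ) :=
    (continuous_id.inner continuous_const).measurable
  have hq : ∀ n j, Measurable fun z : Ω × ℝ => (inner ℝ (b n j z.1) x : ℝ) := fun n j =>
    hin.comp ((hbmeas n j).comp measurable_fst)
  have hset : ∀ n ε, MeasurableSet
      {z : Ω × ℝ | ε ≤ |qrgmm (m n) (fun j => inner ℝ (b n j z.1) x) z.2 - Y z.2|} := fun n ε =>
    measurableSet_le measurable_const
      ((measurable_qrgmm_comp (m n) (hq n) measurable_snd).sub (hY.comp measurable_snd)).abs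
  have hconv : ∀ ε > 0, Tendsto (fun n => (P.prod unifLaw)
      {z | ε ≤ |qrgmm (m n) (fun j => inner ℝ (b n j z.1) x) z.2 - Y z.2|}) atTop (𝓝 0) := by
    intro ε hε
    -- Integrating over the data first reduces the claim to fixed `u`, with the constant `1`
    -- dominating.
    simp only [Measure.prod_apply_symm (hset _ ε)]
    rw [← lintegral_zero (μ := unifLaw)]
    refine tendsto_lintegral_of_dominated_convergence (fun _ => 1)
      (fun n => measurable_measure_prodMk_right (hset n ε))
      (fun n => Eventually.of_forall fun u => prob_le_one) (by simp) ?_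
    filter_upwards [ae_restrict_mem (μ := volume) (measurableSet_Ioo (a := (0 : ℝ)) (b := 1))]
      with u hu
    have h := tendsto_measure_qrgmm hxs hys hlaw hindep h1 h2 h3 hm hb x hu hε
    refine h.congr fun n => ?_
    congr 1
    ext ω
    simp only [mem_ofPred_eq, mem_preimage, hYdef, indicator_of_mem hu]
  have hl : lbar ∈ Icc 0 lbar := ⟨hlbar.le, le_rfl⟩
  have hB0 : 0 ≤ g lbar 0 :=
    (abs_nonneg _).trans (h4.bound lbar hl 0 ⟨le_rfl, (h4.range lbar hl).1⟩)
  have hsub : ∀ l ∈ Icc 0 lbar, Ico 0 (a l) ⊆ Icc 0 (a lbar) := fun l hl' y hy =>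
    ⟨hy.1, hy.2.le.trans (h4.range l hl').2⟩
  have hlip : ∀ l ∈ Icc 0 lbar, ∀ y ∈ Ico 0 (a l), ∀ z ∈ Ico 0 (a l),
      |g l y - g l z| ≤ K * |y - z| := fun l hl' y hy z hz =>
    (h4.lip l hl').dist_le_mul y (hsub l hl' hy) z (hsub l hl' hz)
  constructor
  -- After truncation only `g l` on `[0, a l)` remains, where the Lipschitz condition supplies
  -- measurability.
  · have hind : ∀ l, (Iio (a l)).indicator ((Ici 0).indicator (g l)) =
        (Ico 0 (a l)).indicator (g l) := fun l => by
      rw [indicator_indicator, inter_comm, Ici_inter_Iio]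
    refine riskConverges_of_tendsto hbmeas hac (h1.nonneg x hx) hY hYlaw hconv hB0 K.2
      (fun l hl' => ?_) (fun l hl' y => ?_) (fun l hl' y hy z hz => ?_)
    · rw [hind]
      exact ((h4.lip l hl').continuousOn.mono (hsub l hl')).measurable_indicator measurableSet_Ico
    · rw [hind]
      by_cases hy : y ∈ Ico 0 (a l)
      · rw [indicator_of_mem hy]
        exact h4.bound l hl' y (hsub l hl' hy)
      · rw [indicator_of_notMem hy, abs_zero]
        exact hB0
    · rw [indicator_of_mem (by exact hy.1), indicator_of_mem (by exact hz.1)]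
      exact hlip l hl' y hy z hz
  · intro hgm hgneg
    refine riskConverges_of_tendsto hbmeas hac (h1.nonneg x hx) hY hYlaw hconv hB0 K.2
      (fun l hl' => (hgm l hl').indicator measurableSet_Iio) (fun l hl' y => ?_) hlip
    by_cases hy : y ∈ Iio (a l)
    · rw [indicator_of_mem hy]
      rcases lt_or_ge y 0 with hy0 | hy0
      · exact hgneg l hl' y hy0
      · exact h4.bound l hl' y (hsub l hl' ⟨hy0, hy⟩)
    · rw [indicator_of_notMem hy, abs_zero]
      exact hB0
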